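/- Let $h,n\ge 0$ be integers and let $\gamma_n$ be the standard Gaussian measure on $\mathbb R^n$. Let $\{\mathcal B_i\}_{i=0}^3$ be a standard orthonormal basis of $\mathcal M_2$ (the $2\times 2$ complex matrices): $\mathcal B_0=I$, all $\mathcal B_i$ are Hermitian, and $\tfrac12\operatorname{Tr}(\mathcal B_i^\dagger \mathcal B_j)=\delta_{ij}$. For $\sigma\in\{0,1,2,3\}^h$ put $\mathcal B_\sigma=\mathcal B_{\sigma_1}\otimes\cdots\otimes\mathcal B_{\sigma_h}$ and $|\sigma|=|\{i:\sigma_i\ne 0\}|$. For $\tau\in\mathbb Z_{\ge0}^n$ let $H_\tau(x)=\prod_i H_{\tau_i}(x_i)$ be the normalized (probabilists') Hermite polynomials, which are orthonormal in $L^2(\mathbb C,\gamma_n)$, put $|\tau|=\sum_i\tau_i$, and for $f\in L^2(\mathbb C,\gamma_n)$ let $\widehat f(\tau)=\mathbb E_{x\sim\gamma_n}[H_\tau(x)f(x)]$ and $\deg f=\max\{|\tau|:\widehat f(\tau)\ne0\}$ (with $\deg f=-\infty$ if all coefficients vanish). Call $f$ multilinear if $\widehat f(\tau)\neq 0$ only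 for $\tau\in\{0,1\}^n$. Let $\mathbf P=\sum_{\sigma\in\{0,1,2,3\}^h}p_\sigma(\mathbf g)\,\mathcal B_\sigma$, $\mathbf g\sim\gamma_n$, be a multilinear random operator in $L^2(\mathcal M_2^{\otimes h},\gamma_n)$, i.e. every $p_\sigma\in L^2(\mathbb C,\gamma_n)$ is multilinear. For $p\ge1$ let $N_p(\mathbf P)=\big(\mathbb E\big[2^{-h}\sum_{i=1}^{2^h}s_i(\mathbf P)^p\big]\big)^{1/p}$, where $s_i$ denotes the singular values. For $0\le\rho\le1$ let $$\Gamma_\rho(\mathbf P)=\sum_{\sigma}(U_\rho p_\sigma)(\mathbf g)\;\mathcal T_\rho^{\otimes h}(\mathcal B_\sigma),\qquad U_\rho f(z)=\mathbb E_{x\sim\gamma_n}\big[f(\rho z+\sqrt{1-\rho^2}\,x)\big],\qquad \mathcal T_\rho(M)=\rho M+(1-\rho)\tfrac{\operatorname{Tr}M}{2}I .$$ Then: 1. For every $0\le\rho\le 1/\sqrt3$, $\;N_4(\Gamma_\rho(\mathbf P))\le N_2(\mathbf P)$. 2. For every integer $d\ge0$ with $\max_\sigma(\deg p_\sigma+|\sigma|)\le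 d$, $\;N_4(\mathbf P)\le 3^{d/2}N_2(\mathbf P)$. -/

import Mathlib

open MeasureTheory ProbabilityTheory
open scoped ENNReal

noncomputable section

namespace RandomOp

/-! ### Gaussian space -/

/-- The standard `n`-dimensional normal distribution on `ℝⁿ`. -/
def gaussian (n : ℕ) : Measure (Fin n → ℝ) :=
  Measure.pi (fun _ => gaussianReal 0 1)

/-- The normalized multivariate Hermite polynomial
`H_τ(x) = ∏ i, He_{τ i}(x i) / √((τ i)!)`, where `He_r` is the probabilists' Hermite polynomial. -/
def hermiteFun {n : ℕ} (τ : Fin n → ℕ) (x : Fin n → ℝ) : ℝ :=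
  ∏ i, Polynomial.aeval (x i) (Polynomial.hermite (τ i)) / √((τ i).factorial : ℝ)

/-- The Hermite coefficient `⟨H_τ, f⟩` (the function `H_τ` is real valued). -/
def hermiteCoeff {n : ℕ} (f : (Fin n → ℝ) → ℂ) (τ : Fin n → ℕ) : ℂ :=
  ∫ x, (hermiteFun τ x : ℂ) * f x ∂(gaussian n)

/-- The degree `max {|τ| : f̂(τ) ≠ 0}`; it is `⊥` if all coefficients vanish. -/
def hermiteDegree {n : ℕ} (f : (Fin n → ℝ) → ℂ) : WithBot ℕ∞ :=
  ⨆ (τ : Fin n → ℕ) (_ : hermiteCoeff f τ ≠ 0), (((∑ i, τ i : ℕ) : ℕ∞) : WithBot ℕ∞)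

/-- `f` is multilinear if only the Hermite coefficients with index in `{0,1}ⁿ` can be nonzero. -/
def IsMultilinear {n : ℕ} (f : (Fin n → ℝ) → ℂ) : Prop :=
  ∀ τ : Fin n → ℕ, hermiteCoeff f τ ≠ 0 → ∀ i, τ i = 0 ∨ τ i = 1

/-- The Ornstein–Uhlenbeck operator `U_ρ`. -/
def ornsteinUhlenbeck {n : ℕ} (ρ : ℝ) (f : (Fin n → ℝ) → ℂ) (z : Fin n → ℝ) : ℂ :=
  ∫ x, f (ρ • z + √(1 - ρ ^ 2) • x) ∂(gaussian n)

/-! ### Matrix spaces -/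

/-- The matrix space `M₂`. -/
abbrev Qubit : Type := Matrix (Fin 2) (Fin 2) ℂ

/-- The matrix space `M₂^{⊗ h}`, with rows and columns indexed by `{0,1}^h`. -/
abbrev Qubits (h : ℕ) : Type := Matrix (Fin h → Fin 2) (Fin h → Fin 2) ℂ

/-- The normalized Hilbert–Schmidt inner product `⟨P, Q⟩ = (1/D) Tr (P† Q)` on `D × D` matrices. -/
def normInner {ι : Type*} [Fintype ι] (P Q : Matrix ι ι ℂ) : ℂ :=
  (Fintype.card ι : ℂ)⁻¹ * (P.conjTranspose * Q).trace

/-- A standard orthonormal basis of `M₂`: four Hermitian matrices, orthonormal for `normInner`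
(hence a basis of the four-dimensional space `M₂`), the first of them being the identity. -/
structure IsStandardOrthonormalBasis (B : Fin 4 → Qubit) : Prop where
  zero_eq_one : B 0 = 1
  isHermitian : ∀ i, (B i).IsHermitian
  orthonormal : ∀ i j, normInner (B i) (B j) = if i = j then 1 else 0

/-- The tensor product `A₁ ⊗ ⋯ ⊗ A_h` of matrices in `M₂`. -/
def tensor {h : ℕ} (A : Fin h → Qubit) : Qubits h :=
  Matrix.of fun a b => ∏ i, A i (a i) (b i)

/-- The product basis element `B_σ = B_{σ₁} ⊗ ⋯ ⊗ B_{σ_h}`. -/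
def tensorBasis {h : ℕ} (B : Fin 4 → Qubit) (σ : Fin h → Fin 4) : Qubits h :=
  tensor fun i => B (σ i)

/-- The number of nonzero entries of `σ`. -/
def weight {h : ℕ} (σ : Fin h → Fin 4) : ℕ :=
  (Finset.univ.filter fun i => σ i ≠ 0).card

/-- The noise operator (depolarizing channel) on one qubit,
`T_ρ(P) = ρ P + (1 - ρ) Tr(P ψ) 1` for the maximally mixed state `ψ = 1/2`. -/
def depolarizing (ρ : ℝ) : Qubit →ₗ[ℂ] Qubit where
  toFun P := (ρ : ℂ) • P + ((1 - (ρ : ℂ)) * (P * ((1 / 2 : ℂ) • (1 : Qubit))).trace) • (1 : Qubit)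
  map_add' P Q := by
    simp only [Matrix.add_mul, Matrix.trace_add, mul_add, add_smul, smul_add]
    abel
  map_smul' c P := by
    simp only [Matrix.smul_mul, Matrix.trace_smul, smul_eq_mul, RingHom.id_apply, smul_add,
      smul_smul]
    congr 2 <;> ring

/-- The tensor power `Φ^{⊗ h}` of a linear map on `M₂`: the linear map on `M₂^{⊗ h}` that sends
`E_{c₁ d₁} ⊗ ⋯ ⊗ E_{c_h d_h}` to `Φ(E_{c₁ d₁}) ⊗ ⋯ ⊗ Φ(E_{c_h d_h})`,
where the `E_{c d}` are the matrix units. -/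
def tensorPow (h : ℕ) (Φ : Qubit →ₗ[ℂ] Qubit) (M : Qubits h) : Qubits h :=
  ∑ c : Fin h → Fin 2, ∑ d : Fin h → Fin 2,
    M c d • tensor fun i => Φ (Matrix.single (c i) (d i) 1)

/-- The noise operator `T_ρ^{⊗ h}` on `M₂^{⊗ h}`. -/
def depolarizingPow {h : ℕ} (ρ : ℝ) (M : Qubits h) : Qubits h :=
  tensorPow h (depolarizing ρ) M

/-- The normalized Schatten norm `((1/D) ∑ sᵢ(M)^p)^{1/p}` of a `D × D` matrix, where the
`sᵢ(M)` are its `D` singular values. -/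
def schattenNorm {ι : Type*} [Fintype ι] [DecidableEq ι] (p : ℝ) (M : Matrix ι ι ℂ) : ℝ :=
  ((Fintype.card ι : ℝ)⁻¹ *
    ∑ i ∈ Finset.range (Fintype.card ι), (Matrix.toEuclideanLin M).singularValues i ^ p) ^ (1 / p)

/-! ### Random operators -/

/-- The random operator `∑ σ, p_σ(g) B_σ` as a matrix-valued function of `g ∈ ℝⁿ`. -/
def randomOperator {h n : ℕ} (B : Fin 4 → Qubit) (p : (Fin h → Fin 4) → (Fin n → ℝ) → ℂ)
    (g : Fin n → ℝ) : Qubits h :=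
  ∑ σ, p σ g • tensorBasis B σ

/-- The vector-valued function `(⟨B_σ, P(g)⟩)_σ` associated with `P` under the basis `B`. -/
def assocFun {h n : ℕ} (B : Fin 4 → Qubit) (P : (Fin n → ℝ) → Qubits h)
    (σ : Fin h → Fin 4) (g : Fin n → ℝ) : ℂ :=
  normInner (tensorBasis B σ) (P g)

/-- The hybrid noise operator `Γ_ρ(P) = ∑ σ, (U_ρ p_σ)(g) T_ρ(B_σ)`, where `p` is the
vector-valued function associated with `P` under `B`. -/
def noise {h n : ℕ} (B : Fin 4 → Qubit) (ρ : ℝ) (P : (Fin n → ℝ) → Qubits h)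
    (g : Fin n → ℝ) : Qubits h :=
  ∑ σ, ornsteinUhlenbeck ρ (assocFun B P σ) g • depolarizingPow ρ (tensorBasis B σ)

/-- The normalized norm `N_p(P) = (E ‖P(g)‖_p^p)^{1/p}`, with values in `[0, ∞]`. -/
def normN {h n : ℕ} (p : ℝ) (P : (Fin n → ℝ) → Qubits h) : ℝ≥0∞ :=
  (∫⁻ g, ENNReal.ofReal (schattenNorm p (P g) ^ p) ∂(gaussian n)) ^ (1 / p)

/-- The total degree `max_σ (deg p_σ + |σ|)`; terms with `deg p_σ = ⊥` do not contribute. -/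
def totalDegree {h n : ℕ} (p : (Fin h → Fin 4) → (Fin n → ℝ) → ℂ) : WithBot ℕ∞ :=
  ⨆ σ, (hermiteDegree (p σ) + ((weight σ : ℕ∞) : WithBot ℕ∞))

end RandomOp

end

/-!
The inequality is proved by expanding the fourth moment completely. With `√2` times the matrix
units as orthonormal basis of each `M₂` and the monomials `1, x` as orthonormal basis for each
Gaussian variable, `E 2⁻ʰ Tr (P†P P†P)` of a smoothed operator `P` is a sum over quadruples of
basis indices of a product of four coefficients (two of them conjugated) and a kernel, and the
kernel is a product over the qubits and the Gaussian variables. Choosing matrix units rather than a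
Hermitian basis makes all kernel values nonnegative: the images of the matrix units under the
depolarizing channel have nonnegative entries, and so do the Gaussian moments. Hence the
coefficients may be replaced by their absolute values, and it remains to bound a quadrilinear form
by the product of the Euclidean norms of its arguments, on vectors with nonnegative entries
(`IsContractive`).

In this multilinear form the bound passes to tensor products (`IsContractive.prod`), so only one
qubit and one Gaussian variable have to be considered, where `3 ρ² ≤ 1` is used. For a qubit,
Hölder's inequality for the trace (`trace_four_pow_le`) reduces the claim to a polynomial
inequality for a real `2 × 2` matrix (`two_mul_frobSq_depol_le`); for a Gaussian variable, two
applications of the Cauchy–Schwarz inequality suffice (`isContractive_gaussKernel`). Together they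
give `integral_trace_smoothed_le`.

To apply this, an abstract multilinear `L²` function has to be identified with the polynomial given
by its Hermite coefficients (`IsMultilinear.ae_eq`). This is the completeness of the Hermite
polynomials, `ae_eq_zero_of_hermiteCoeff`: a function with vanishing coefficients is orthogonal to
all polynomials, hence has vanishing Fourier transform. The Ornstein–Uhlenbeck operator respects
almost everywhere equality by rotation invariance, and it multiplies a multilinear monomial of
degree `k` by `ρᵏ`, as the depolarizing channel does with a basis element of weight `k`; this gives
the first inequality. For the second, `P` is the image under the noise with `ρ = 1/√3` of the
operator whose coefficients of total degree `k` are multiplied by `3^{k/2}`.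
-/

noncomputable section

namespace RandomOp

/-! ### Contractive quadrilinear forms -/

/-- The kernel of a quadrilinear form on `ℝ^κ` is *contractive* if it is nonnegative and the form
is bounded by the product of the Euclidean norms on vectors with nonnegative entries. -/
structure IsContractive {κ : Type*} [Fintype κ] (K : (Fin 4 → κ) → ℝ) : Prop where
  nonneg : ∀ s, 0 ≤ K s
  le : ∀ a : Fin 4 → κ → ℝ, (∀ m i, 0 ≤ a m i) →
    ∑ s, K s * ∏ m, a m (s m) ≤ ∏ m, √(∑ i, a m i ^ 2)

/-- Contractivity is inherited by the tensor product of two kernels: fixing the first indices, the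
second form is bounded by the norms of the slices, and these norms are then fed to the first. -/
theorem IsContractive.prod {κ l : Type*} [Fintype κ] [Fintype l]
    {K : (Fin 4 → κ) → ℝ} {L : (Fin 4 → l) → ℝ}
    (hK : IsContractive K) (hL : IsContractive L) :
    IsContractive fun s : Fin 4 → κ × l => K (fun m => (s m).1) * L (fun m => (s m).2) where
  nonneg s := mul_nonneg (hK.nonneg _) (hL.nonneg _)
  le a ha := by
    classical
    rw [← (Equiv.arrowProdEquivProdArrow (Fin 4) (fun _ => κ) (fun _ => l)).symm.sum_comp,
      Fintype.sum_prod_type]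
    calc ∑ s : Fin 4 → κ, ∑ t : Fin 4 → l, K s * L t * ∏ m, a m (s m, t m)
        = ∑ s : Fin 4 → κ, K s * ∑ t : Fin 4 → l, L t * ∏ m, a m (s m, t m) := by
          simp only [Finset.mul_sum, mul_assoc]
      _ ≤ ∑ s : Fin 4 → κ, K s * ∏ m, √(∑ j, a m (s m, j) ^ 2) :=
          Finset.sum_le_sum fun s _ => mul_le_mul_of_nonneg_left
            (hL.le (fun m j => a m (s m, j)) fun m j => ha m _) (hK.nonneg s)
      _ ≤ ∏ m, √(∑ i, √(∑ j, a m (i, j) ^ 2) ^ 2) :=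
          hK.le (fun m i => √(∑ j, a m (i, j) ^ 2)) fun m i => Real.sqrt_nonneg _
      _ = ∏ m, √(∑ i, a m i ^ 2) := by
          refine Finset.prod_congr rfl fun m _ => ?_
          rw [Fintype.sum_prod_type]
          congr 1
          exact Finset.sum_congr rfl fun i _ =>
            Real.sq_sqrt (Finset.sum_nonneg fun j _ => sq_nonneg _)

theorem IsContractive.comp_equiv {κ l : Type*} [Fintype κ] [Fintype l]
    {K : (Fin 4 → κ) → ℝ} (hK : IsContractive K) (e : l ≃ κ) :
    IsContractive fun s : Fin 4 → l => K fun m => e (s m) where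
  nonneg s := hK.nonneg _
  le a ha := by
    classical
    have := hK.le (fun m i => a m (e.symm i)) fun m i => ha m _
    rw [← (Equiv.arrowCongr (Equiv.refl (Fin 4)) e).sum_comp] at this
    simpa [← e.sum_comp, Equiv.arrowCongr, Function.comp_def] using this

theorem IsContractive.pi {κ : Type*} [Fintype κ] {K : (Fin 4 → κ) → ℝ} (hK : IsContractive K)
    (h : ℕ) : IsContractive fun s : Fin 4 → Fin h → κ => ∏ i, K fun m => s m i := by
  induction h with
  | zero =>
    refine ⟨fun s => by simp, fun a ha => ?_⟩
    simp [Finset.univ_unique, Real.sqrt_sq, ha]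
  | succ h ih =>
    simpa [Fin.prod_univ_succ, Fin.consEquiv, Fin.tail] using
      (hK.prod ih).comp_equiv (Fin.consEquiv fun _ : Fin (h + 1) => κ).symm

theorem sum_fin_four {κ M : Type*} [Fintype κ] [AddCommMonoid M] (f : (Fin 4 → κ) → M) :
    ∑ s, f s = ∑ i, ∑ j, ∑ k, ∑ l, f ![i, j, k, l] := by
  classical
  let e : (κ × κ × κ × κ) ≃ (Fin 4 → κ) :=
    { toFun := fun q => ![q.1, q.2.1, q.2.2.1, q.2.2.2]
      invFun := fun s => (s 0, s 1, s 2, s 3)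
      left_inv := fun q => rfl
      right_inv := fun s => by ext m; fin_cases m <;> rfl }
  rw [← e.sum_comp]
  simp only [Fintype.sum_prod_type]
  rfl

theorem trace_four_sum {ι κ R : Type*} [Fintype ι] [Fintype κ] [NonUnitalSemiring R]
    (A B C D : κ → Matrix ι ι R) :
    ((∑ e, A e) * (∑ e, B e) * ((∑ e, C e) * ∑ e, D e)).trace =
      ∑ s : Fin 4 → κ, (A (s 0) * B (s 1) * (C (s 2) * D (s 3))).trace := by
  rw [sum_fin_four]
  simp only [Finset.sum_mul_sum, Matrix.trace_sum]
  exact Finset.sum_congr rfl fun i _ => Finset.sum_comm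

/-! ### The kernel of one qubit -/

/-- The squared Hilbert–Schmidt norm of a real matrix. -/
def frobSq {ι κ : Type*} [Fintype ι] [Fintype κ] (X : Matrix ι κ ℝ) : ℝ :=
  ∑ i, ∑ j, X i j ^ 2

theorem frobSq_nonneg {ι κ : Type*} [Fintype ι] [Fintype κ] (X : Matrix ι κ ℝ) : 0 ≤ frobSq X :=
  Finset.sum_nonneg fun _ _ => Finset.sum_nonneg fun _ _ => sq_nonneg _

theorem frobSq_eq_trace {ι κ : Type*} [Fintype ι] [Fintype κ] (X : Matrix ι κ ℝ) :
    frobSq X = (X.transpose * X).trace := by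
  simp only [frobSq, Matrix.trace, Matrix.diag, Matrix.mul_apply, Matrix.transpose_apply, sq]
  exact Finset.sum_comm

theorem trace_transpose_mul_sq_le {ι κ : Type*} [Fintype ι] [Fintype κ] (X Y : Matrix ι κ ℝ) :
    (X.transpose * Y).trace ^ 2 ≤ frobSq X * frobSq Y := by
  have h := Finset.sum_mul_sq_le_sq_mul_sq (Finset.univ : Finset (κ × ι))
    (fun q => X q.2 q.1) fun q => Y q.2 q.1
  simp only [Fintype.sum_prod_type] at h
  rw [frobSq, frobSq, Finset.sum_comm, Finset.sum_comm (f := fun i j => Y i j ^ 2)]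
  simpa only [Matrix.trace, Matrix.diag, Matrix.mul_apply, Matrix.transpose_apply] using h

theorem frobSq_transpose_mul_sq_le {ι : Type*} [Fintype ι] (A B : Matrix ι ι ℝ) :
    frobSq (A.transpose * B) ^ 2 ≤
      frobSq (A.transpose * A) * frobSq (B.transpose * B) := by
  have key : ∀ X : Matrix ι ι ℝ, frobSq (X * X.transpose) = frobSq (X.transpose * X) := fun X => by
    rw [frobSq_eq_trace, frobSq_eq_trace]
    simp only [Matrix.transpose_mul, Matrix.transpose_transpose]
    rw [Matrix.mul_assoc, Matrix.trace_mul_comm]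
    simp only [Matrix.mul_assoc]
  have h := trace_transpose_mul_sq_le (A * A.transpose) (B * B.transpose)
  rw [key, key] at h
  convert h using 2
  rw [frobSq_eq_trace, ← Matrix.mul_assoc, Matrix.trace_mul_comm, Matrix.transpose_mul,
    Matrix.transpose_transpose, Matrix.transpose_mul, Matrix.transpose_transpose,
    Matrix.trace_mul_comm (A * A.transpose)]
  simp only [Matrix.mul_assoc]

/-- Hölder's inequality for the trace of a product of four matrices, in the Schatten `4`-norm. -/
theorem trace_four_pow_le {ι : Type*} [Fintype ι] (A : Fin 4 → Matrix ι ι ℝ) :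
    ((A 0).transpose * A 1 * ((A 2).transpose * A 3)).trace ^ 4 ≤
      ∏ m, frobSq ((A m).transpose * A m) := by
  have h := trace_transpose_mul_sq_le ((A 1).transpose * A 0) ((A 2).transpose * A 3)
  rw [Matrix.transpose_mul, Matrix.transpose_transpose] at h
  have h1 := frobSq_transpose_mul_sq_le (A 1) (A 0)
  have h2 := frobSq_transpose_mul_sq_le (A 2) (A 3)
  calc _ = (((A 0).transpose * A 1 * ((A 2).transpose * A 3)).trace ^ 2) ^ 2 := by ring
    _ ≤ (frobSq ((A 1).transpose * A 0) * frobSq ((A 2).transpose * A 3)) ^ 2 := by gcongr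
    _ = frobSq ((A 1).transpose * A 0) ^ 2 * frobSq ((A 2).transpose * A 3) ^ 2 := by ring
    _ ≤ (frobSq ((A 1).transpose * A 1) * frobSq ((A 0).transpose * A 0)) *
          (frobSq ((A 2).transpose * A 2) * frobSq ((A 3).transpose * A 3)) :=
        mul_le_mul h1 h2 (sq_nonneg _) (mul_nonneg (frobSq_nonneg _) (frobSq_nonneg _))
    _ = _ := by rw [Fin.prod_univ_four]; ring

/-- The image of the matrix unit `E_{c d}` under the depolarizing channel, as a real matrix. -/
def depolUnit (ρ : ℝ) (e : Fin 2 × Fin 2) : Matrix (Fin 2) (Fin 2) ℝ :=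
  Matrix.of fun i j => (if e = (i, j) then ρ else 0) +
    if e.1 = e.2 ∧ i = j then (1 - ρ) / 2 else 0

/-- The quadrilinear kernel of one qubit: fourfold traces of the images of the matrix units under
the depolarizing channel. The factor `2` accounts for the normalization of the matrix units. -/
def qubitKernel (ρ : ℝ) (s : Fin 4 → Fin 2 × Fin 2) : ℝ :=
  2 * ((depolUnit ρ (s 0)).transpose * depolUnit ρ (s 1) *
    ((depolUnit ρ (s 2)).transpose * depolUnit ρ (s 3))).trace

theorem depolUnit_nonneg {ρ : ℝ} (h0 : 0 ≤ ρ) (h1 : 3 * ρ ^ 2 ≤ 1) (e : Fin 2 × Fin 2)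
    (i j : Fin 2) : 0 ≤ depolUnit ρ e i j := by
  have : ρ ≤ 1 := by nlinarith
  have : 0 ≤ (1 - ρ) / 2 := by linarith
  simp only [depolUnit, Matrix.of_apply]
  positivity

/-- The scalar hypercontractive inequality for one qubit: in the coordinates
`(α, x, y, z) = ((a + d) / 2, (b + c) / 2, (b - c) / 2, (a - d) / 2)` of a real matrix the left side
is `4 ((α² + ρ² |v|²)² + 4 α² ρ² (x² + z²) + 4 ρ⁴ (x² + z²) y²)` with `v = (x, y, z)`. -/
theorem two_mul_frobSq_depol_le {ρ : ℝ} (h1 : 3 * ρ ^ 2 ≤ 1) (a : Fin 2 × Fin 2 → ℝ) :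
    2 * frobSq ((∑ e, a e • depolUnit ρ e).transpose * ∑ e, a e • depolUnit ρ e) ≤
      (∑ e, a e ^ 2) ^ 2 := by
  obtain ⟨α, hα⟩ : ∃ α, α = (a (0, 0) + a (1, 1)) / 2 := ⟨_, rfl⟩
  obtain ⟨z, hz⟩ : ∃ z, z = (a (0, 0) - a (1, 1)) / 2 := ⟨_, rfl⟩
  obtain ⟨x, hx⟩ : ∃ x, x = (a (0, 1) + a (1, 0)) / 2 := ⟨_, rfl⟩
  obtain ⟨y, hy⟩ : ∃ y, y = (a (0, 1) - a (1, 0)) / 2 := ⟨_, rfl⟩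
  have e00 : a (0, 0) = α + z := by rw [hα, hz]; ring
  have e11 : a (1, 1) = α - z := by rw [hα, hz]; ring
  have e01 : a (0, 1) = x + y := by rw [hx, hy]; ring
  have e10 : a (1, 0) = x - y := by rw [hx, hy]; ring
  have lhs : frobSq ((∑ e, a e • depolUnit ρ e).transpose * ∑ e, a e • depolUnit ρ e) =
      2 * ((α ^ 2 + ρ ^ 2 * (x ^ 2 + y ^ 2 + z ^ 2)) ^ 2 + 4 * α ^ 2 * ρ ^ 2 * (x ^ 2 + z ^ 2) +
        4 * ρ ^ 2 * ρ ^ 2 * (x ^ 2 + z ^ 2) * y ^ 2) := by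
    simp only [frobSq, Matrix.mul_apply, Matrix.transpose_apply, Fintype.sum_prod_type,
      Fin.sum_univ_two, e00, e01, e10, e11]
    simp [depolUnit]
    ring
  have rhs : ∑ e, a e ^ 2 = 2 * (α ^ 2 + (x ^ 2 + y ^ 2 + z ^ 2)) := by
    simp only [Fintype.sum_prod_type, Fin.sum_univ_two, e00, e01, e10, e11]
    ring
  rw [lhs, rhs]
  obtain ⟨r, hr⟩ : ∃ r, r = ρ ^ 2 := ⟨_, rfl⟩
  have hr0 : 0 ≤ r := hr ▸ sq_nonneg ρ
  rw [← hr] at h1 ⊢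
  have hrr : r * r ≤ 1 / 9 := by nlinarith
  obtain ⟨u, hu⟩ : ∃ u, u = x ^ 2 + z ^ 2 := ⟨_, rfl⟩
  have hu0 : 0 ≤ u := by rw [hu]; positivity
  have hv : x ^ 2 + y ^ 2 + z ^ 2 = u + y ^ 2 := by rw [hu]; ring
  rw [hv, ← hu]
  have i1 : r * (α ^ 2 * (6 * u + 2 * y ^ 2)) ≤ 1 / 3 * (α ^ 2 * (6 * u + 2 * y ^ 2)) :=
    mul_le_mul_of_nonneg_right (by linarith) (by positivity)
  have i2 : r * r * ((u + y ^ 2) ^ 2 + 4 * u * y ^ 2) ≤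
      1 / 9 * ((u + y ^ 2) ^ 2 + 4 * u * y ^ 2) :=
    mul_le_mul_of_nonneg_right hrr (by positivity)
  have i3 : 0 ≤ α ^ 2 * y ^ 2 := by positivity
  nlinarith [sq_nonneg (u - y ^ 2), mul_nonneg hu0 (sq_nonneg y)]

theorem isContractive_qubitKernel {ρ : ℝ} (h0 : 0 ≤ ρ) (h1 : 3 * ρ ^ 2 ≤ 1) :
    IsContractive (qubitKernel ρ) where
  nonneg s := by
    have h := depolUnit_nonneg h0 h1
    simp only [qubitKernel, Matrix.trace, Matrix.diag, Matrix.mul_apply, Matrix.transpose_apply]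
    refine mul_nonneg zero_le_two (Finset.sum_nonneg fun i _ => Finset.sum_nonneg fun j _ =>
      mul_nonneg (Finset.sum_nonneg fun k _ => mul_nonneg (h _ _ _) (h _ _ _))
        (Finset.sum_nonneg fun k _ => mul_nonneg (h _ _ _) (h _ _ _)))
  le a _ := by
    have expand : ∑ s, qubitKernel ρ s * ∏ m, a m (s m) =
        2 * ((∑ e, a 0 e • depolUnit ρ e).transpose * (∑ e, a 1 e • depolUnit ρ e) *
          ((∑ e, a 2 e • depolUnit ρ e).transpose * (∑ e, a 3 e • depolUnit ρ e))).trace := by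
      simp only [Matrix.transpose_sum, Matrix.transpose_smul]
      rw [trace_four_sum, Finset.mul_sum]
      refine Finset.sum_congr rfl fun s _ => ?_
      simp only [qubitKernel, Matrix.smul_mul, Matrix.mul_smul, Matrix.trace_smul, smul_eq_mul,
        Fin.prod_univ_four]
      ring
    rw [expand]
    have hol := trace_four_pow_le fun m => ∑ e, a m e • depolUnit ρ e
    refine le_of_pow_le_pow_left₀ (n := 4) (by norm_num)
      (Finset.prod_nonneg fun m _ => Real.sqrt_nonneg _) ?_
    calc _ = 16 * ((∑ e, a 0 e • depolUnit ρ e).transpose * (∑ e, a 1 e • depolUnit ρ e) *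
          ((∑ e, a 2 e • depolUnit ρ e).transpose * (∑ e, a 3 e • depolUnit ρ e))).trace ^ 4 := by
          ring
      _ ≤ 16 * ∏ m, frobSq ((∑ e, a m e • depolUnit ρ e).transpose *
            ∑ e, a m e • depolUnit ρ e) := by gcongr
      _ = ∏ m, 2 * frobSq ((∑ e, a m e • depolUnit ρ e).transpose *
            ∑ e, a m e • depolUnit ρ e) := by
          rw [Fin.prod_univ_four, Fin.prod_univ_four]; ring
      _ ≤ ∏ m, (∑ e, a m e ^ 2) ^ 2 :=
          Finset.prod_le_prod (fun m _ => mul_nonneg zero_le_two (frobSq_nonneg _))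
            fun m _ => two_mul_frobSq_depol_le h1 (a m)
      _ = _ := by
          rw [← Finset.prod_pow]
          refine Finset.prod_congr rfl fun m _ => ?_
          rw [show (4 : ℕ) = 2 * 2 from rfl, pow_mul,
            Real.sq_sqrt (Finset.sum_nonneg fun j _ => sq_nonneg _)]

/-! ### The kernel of one Gaussian variable -/

/-- The quadrilinear kernel of one Gaussian variable: fourfold moments of the functions `1` and
`ρ x`. -/
def gaussKernel (ρ : ℝ) (s : Fin 4 → Fin 2) : ℝ :=
  ∫ x, ∏ m, (ρ * x) ^ (s m : ℕ) ∂(gaussianReal 0 1)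

theorem integrable_pow_gaussianReal (k : ℕ) :
    Integrable (fun x : ℝ => x ^ k) (gaussianReal 0 1) :=
  integrable_pow_of_mem_interior_integrableExpSet (X := fun x => x)
    (by simp [integrableExpSet_fun_id_gaussianReal]) k

theorem integrable_eval_gaussianReal (P : Polynomial ℝ) :
    Integrable (fun x : ℝ => P.eval x) (gaussianReal 0 1) := by
  simp only [Polynomial.eval_eq_sum_range]
  exact integrable_finsetSum _ fun i _ => (integrable_pow_gaussianReal i).const_mul _

/-- Gaussian integration by parts for polynomials. -/
theorem integral_eval_mul_id_gaussianReal (P : Polynomial ℝ) :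
    ∫ x, x * P.eval x ∂(gaussianReal 0 1) = ∫ x, P.derivative.eval x ∂(gaussianReal 0 1) := by
  -- The density times `P` has an integrable derivative, whose integral vanishes.
  have hd : ∀ x, HasDerivAt (fun x => gaussianPDFReal 0 1 x * P.eval x)
      (gaussianPDFReal 0 1 x * (P.derivative - Polynomial.X * P).eval x) x := fun x => by
    have h1 : HasDerivAt (gaussianPDFReal 0 1) (gaussianPDFReal 0 1 x * (-x)) x := by
      simp only [gaussianPDFReal_def]
      have h2 : HasDerivAt (fun x : ℝ => -(x - 0) ^ 2 / (2 * ((1 : NNReal) : ℝ))) (-x) x := by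
        have := (((hasDerivAt_id x).sub_const 0).pow 2).neg.div_const (2 * ((1 : NNReal) : ℝ))
        refine this.congr_deriv ?_
        simp
        ring
      refine (h2.exp.const_mul _).congr_deriv ?_
      ring
    refine (h1.mul (P.hasDerivAt x)).congr_deriv ?_
    simp
    ring
  have hint : ∀ Q : Polynomial ℝ,
      Integrable fun x => gaussianPDFReal 0 1 x * Q.eval x := fun Q => by
    have h := integrable_eval_gaussianReal Q
    rw [gaussianReal_of_var_ne_zero _ one_ne_zero,
      integrable_withDensity_iff_integrable_smul' (measurable_gaussianPDF _ _)
        (Filter.Eventually.of_forall fun x => gaussianPDF_lt_top)] at h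
    simpa only [toReal_gaussianPDF, smul_eq_mul] using h
  have h := integral_eq_zero_of_hasDerivAt_of_integrable hd (hint _) (hint _)
  have h' := integral_gaussianReal_eq_integral_smul (μ := 0) (v := 1) one_ne_zero
    (f := fun x => (P.derivative - Polynomial.X * P).eval x)
  simp only [smul_eq_mul] at h'
  rw [h] at h'
  have e : ∫ x, (P.derivative.eval x - (Polynomial.X * P).eval x) ∂(gaussianReal 0 1) = 0 := by
    simpa using h'
  rw [integral_sub (integrable_eval_gaussianReal _) (integrable_eval_gaussianReal _)] at e
  simp only [Polynomial.eval_mul, Polynomial.eval_X] at e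
  linarith

theorem integral_pow_add_two_gaussianReal (k : ℕ) :
    ∫ x, x ^ (k + 2) ∂(gaussianReal 0 1) = (k + 1) * ∫ x, x ^ k ∂(gaussianReal 0 1) := by
  have h := integral_eval_mul_id_gaussianReal (Polynomial.X ^ (k + 1))
  simp only [Polynomial.eval_pow, Polynomial.eval_X, Polynomial.derivative_X_pow,
    Polynomial.eval_mul, Polynomial.eval_C, integral_const_mul] at h
  simp only [← pow_succ'] at h
  simpa using h

theorem integral_gaussianReal_pow_nonneg (k : ℕ) : 0 ≤ ∫ x, x ^ k ∂(gaussianReal 0 1) := by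
  induction k using Nat.twoStepInduction with
  | zero => simp
  | one => simp [integral_id_gaussianReal]
  | more k ih _ =>
    rw [integral_pow_add_two_gaussianReal]
    positivity

theorem gaussKernel_eq (ρ : ℝ) (s : Fin 4 → Fin 2) :
    gaussKernel ρ s = ρ ^ (∑ m, (s m : ℕ)) * ∫ x, x ^ (∑ m, (s m : ℕ)) ∂(gaussianReal 0 1) := by
  simp only [gaussKernel, mul_pow, Finset.prod_mul_distrib, Finset.prod_pow_eq_pow_sum,
    integral_const_mul]

theorem isContractive_gaussKernel {ρ : ℝ} (h0 : 0 ≤ ρ) (h1 : 3 * ρ ^ 2 ≤ 1) :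
    IsContractive (gaussKernel ρ) where
  nonneg s := by
    rw [gaussKernel_eq]
    exact mul_nonneg (pow_nonneg h0 _) (integral_gaussianReal_pow_nonneg _)
  le a _ := by
    have m1 : ∫ x, x ∂(gaussianReal 0 1) = 0 := integral_id_gaussianReal
    have m2 : ∫ x, x ^ 2 ∂(gaussianReal 0 1) = 1 := by
      simpa using integral_pow_add_two_gaussianReal 0
    have m3 : ∫ x, x ^ 3 ∂(gaussianReal 0 1) = 0 := by
      simpa [m1] using integral_pow_add_two_gaussianReal 1
    have m4 : ∫ x, x ^ 4 ∂(gaussianReal 0 1) = 3 := by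
      have := integral_pow_add_two_gaussianReal 2
      rw [m2] at this
      norm_num at this ⊢
      exact this
    obtain ⟨r, hr⟩ : ∃ r, r = ρ ^ 2 := ⟨_, rfl⟩
    have hr0 : 0 ≤ r := hr ▸ sq_nonneg ρ
    have hrr : r ^ 2 ≤ 1 / 9 := by nlinarith
    -- The covariance form of the products `(a + ρ b x) (c + ρ d x)` of two affine functions.
    -- The remaining factor `2 r²` is the variance of the term `ρ² b d x²`.
    have expand : ∑ s, gaussKernel ρ s * ∏ m, a m (s m) =
        (a 0 0 * a 1 0 + r * (a 0 1 * a 1 1)) * (a 2 0 * a 3 0 + r * (a 2 1 * a 3 1)) +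
        r * ((a 0 0 * a 1 1 + a 0 1 * a 1 0) * (a 2 0 * a 3 1 + a 2 1 * a 3 0)) +
        2 * r ^ 2 * (a 0 1 * a 1 1 * (a 2 1 * a 3 1)) := by
      rw [sum_fin_four]
      simp only [gaussKernel_eq, Fin.sum_univ_four, Fin.prod_univ_four, Matrix.cons_val,
        Fin.sum_univ_two]
      simp [m1, m2, m3, m4, hr]
      ring
    have bound : ∀ b c : Fin 2 → ℝ, (b 0 * c 0 + r * (b 1 * c 1)) ^ 2 +
        r * (b 0 * c 1 + b 1 * c 0) ^ 2 + 2 * r ^ 2 * (b 1 * c 1) ^ 2 ≤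
        (b 0 ^ 2 + b 1 ^ 2) * (c 0 ^ 2 + c 1 ^ 2) := fun b c => by
      have i1 : r * (3 * ((b 0 * c 1) ^ 2 + (b 1 * c 0) ^ 2)) ≤
          (b 0 * c 1) ^ 2 + (b 1 * c 0) ^ 2 := by
        have := mul_le_mul_of_nonneg_right (show 3 * r ≤ 1 by rw [hr]; exact h1)
          (show 0 ≤ (b 0 * c 1) ^ 2 + (b 1 * c 0) ^ 2 by positivity)
        linarith
      have i2 : r ^ 2 * (b 1 * c 1) ^ 2 ≤ 1 / 9 * (b 1 * c 1) ^ 2 :=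
        mul_le_mul_of_nonneg_right hrr (sq_nonneg _)
      have i3 : 0 ≤ r * (b 0 * c 1 - b 1 * c 0) ^ 2 := by positivity
      nlinarith [sq_nonneg (b 1 * c 1)]
    have cs : ∀ u v w u' v' w' : ℝ, (u * u' + r * (v * v') + 2 * r ^ 2 * (w * w')) ^ 2 ≤
        (u ^ 2 + r * v ^ 2 + 2 * r ^ 2 * w ^ 2) *
          (u' ^ 2 + r * v' ^ 2 + 2 * r ^ 2 * w' ^ 2) := fun u v w u' v' w' => by
      have i1 : 0 ≤ r * (u * v' - v * u') ^ 2 := by positivity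
      have i2 : 0 ≤ r ^ 2 * (u * w' - w * u') ^ 2 := by positivity
      have i3 : 0 ≤ r ^ 3 * (v * w' - w * v') ^ 2 := by positivity
      linear_combination i1 + 2 * i2 + 2 * i3
    rw [expand]
    have hprod : ∏ m, √(∑ i, a m i ^ 2) = √(∏ m, ∑ i, a m i ^ 2) :=
      (Real.sqrt_prod _ fun m _ => Finset.sum_nonneg fun i _ => sq_nonneg _).symm
    rw [hprod]
    refine Real.le_sqrt_of_sq_le ((cs _ _ _ _ _ _).trans ?_)
    rw [Fin.prod_univ_four]
    simp only [Fin.sum_univ_two]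
    exact (mul_le_mul (bound (a 0) (a 1)) (bound (a 2) (a 3)) (by positivity)
      (by positivity)).trans_eq (mul_assoc _ _ _).symm

/-! ### Tensor products of matrices -/

theorem tensor_conjTranspose {h : ℕ} (A : Fin h → Qubit) :
    (tensor A).conjTranspose = tensor fun i => (A i).conjTranspose := by
  ext a b
  simp [tensor]

theorem tensor_mul {h : ℕ} (A B : Fin h → Qubit) :
    tensor A * tensor B = tensor fun i => A i * B i := by
  ext a b
  simp only [tensor, Matrix.mul_apply, Matrix.of_apply, ← Finset.prod_mul_distrib]
  exact (Fintype.prod_sum fun i j => A i (a i) j * B i j (b i)).symm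

theorem trace_tensor {h : ℕ} (A : Fin h → Qubit) : (tensor A).trace = ∏ i, (A i).trace := by
  simp only [tensor, Matrix.trace, Matrix.diag, Matrix.of_apply]
  exact (Fintype.prod_sum fun i j => A i j j).symm

theorem depolarizing_single (ρ : ℝ) (c d : Fin 2) :
    depolarizing ρ (Matrix.single c d 1) = (depolUnit ρ (c, d)).map Complex.ofReal := by
  ext i j
  simp only [depolarizing, LinearMap.coe_mk, AddHom.coe_mk, Matrix.map_apply, depolUnit,
    Matrix.of_apply]
  fin_cases c <;> fin_cases d <;> fin_cases i <;> fin_cases j <;>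
    simp [div_eq_mul_inv]

/-- The expansion of the depolarizing channel in the matrix units. -/
theorem depolarizingPow_eq_sum {h : ℕ} (ρ : ℝ) (M : Qubits h) :
    depolarizingPow ρ M = ∑ e : Fin h → Fin 2 × Fin 2,
      M (fun i => (e i).1) (fun i => (e i).2) •
        tensor fun i => (depolUnit ρ (e i)).map Complex.ofReal := by
  rw [← (Equiv.arrowProdEquivProdArrow (Fin h) (fun _ => Fin 2) (fun _ => Fin 2)).symm.sum_comp,
    Fintype.sum_prod_type]
  simp only [depolarizingPow, tensorPow, depolarizing_single]
  rfl

/-- Fourfold traces of the images of matrix units factor over the qubits. -/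
theorem trace_tensor_depolUnit (h : ℕ) (ρ : ℝ) (s : Fin 4 → Fin h → Fin 2 × Fin 2) :
    ((tensor fun i => (depolUnit ρ (s 0 i)).map Complex.ofReal).conjTranspose *
      (tensor fun i => (depolUnit ρ (s 1 i)).map Complex.ofReal) *
      ((tensor fun i => (depolUnit ρ (s 2 i)).map Complex.ofReal).conjTranspose *
        tensor fun i => (depolUnit ρ (s 3 i)).map Complex.ofReal)).trace =
      (((2 ^ h)⁻¹ * ∏ i, qubitKernel ρ fun m => s m i : ℝ) : ℂ) := by
  have key : ∀ i, (((depolUnit ρ (s 0 i)).map Complex.ofReal).conjTranspose *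
      (depolUnit ρ (s 1 i)).map Complex.ofReal *
      (((depolUnit ρ (s 2 i)).map Complex.ofReal).conjTranspose *
        (depolUnit ρ (s 3 i)).map Complex.ofReal)).trace =
      ((2⁻¹ * qubitKernel ρ fun m => s m i : ℝ) : ℂ) := fun i => by
    simp [qubitKernel, Matrix.trace, Matrix.mul_apply]
  simp only [tensor_conjTranspose, tensor_mul, trace_tensor, key]
  rw [← Complex.ofReal_prod, Finset.prod_mul_distrib]
  simp

/-! ### The fourth moment of a smoothed random operator -/

/-- The random operator `∑_S ∏ᵢ (ρ gᵢ)^{Sᵢ} T_ρ^{⊗ h}(M_S)` obtained by applying the noise to the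
multilinear polynomial `∑_S g^S M_S` with matrix coefficients. -/
def smoothed {h n : ℕ} (ρ : ℝ) (M : (Fin n → Fin 2) → Qubits h) (g : Fin n → ℝ) : Qubits h :=
  ∑ S : Fin n → Fin 2, ((∏ i, (ρ * g i) ^ (S i : ℕ) : ℝ) : ℂ) • depolarizingPow ρ (M S)

/-- The fourth moment as a quadrilinear expression in the matrix entries of the coefficients. -/
theorem trace_smoothed {h n : ℕ} (ρ : ℝ) (M : (Fin n → Fin 2) → Qubits h) (g : Fin n → ℝ) :
    ((smoothed ρ M g).conjTranspose * smoothed ρ M g *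
      ((smoothed ρ M g).conjTranspose * smoothed ρ M g)).trace.re =
    ∑ s : Fin 4 → (Fin h → Fin 2 × Fin 2) × (Fin n → Fin 2),
      ((starRingEnd ℂ (M (s 0).2 (fun i => ((s 0).1 i).1) (fun i => ((s 0).1 i).2)) *
        M (s 1).2 (fun i => ((s 1).1 i).1) (fun i => ((s 1).1 i).2) *
        starRingEnd ℂ (M (s 2).2 (fun i => ((s 2).1 i).1) (fun i => ((s 2).1 i).2)) *
        M (s 3).2 (fun i => ((s 3).1 i).1) (fun i => ((s 3).1 i).2)).re *
        ((2 ^ h)⁻¹ * ∏ i, qubitKernel ρ fun m => (s m).1 i)) *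
        ∏ i, ∏ m, (ρ * g i) ^ ((s m).2 i : ℕ) := by
  have hsum : smoothed ρ M g = ∑ e : (Fin h → Fin 2 × Fin 2) × (Fin n → Fin 2),
      (((∏ i, (ρ * g i) ^ (e.2 i : ℕ) : ℝ) : ℂ) *
        M e.2 (fun i => (e.1 i).1) (fun i => (e.1 i).2)) •
        tensor fun i => (depolUnit ρ (e.1 i)).map Complex.ofReal := by
    simp only [smoothed, depolarizingPow_eq_sum, Finset.smul_sum, smul_smul]
    rw [Fintype.sum_prod_type_right]
  rw [hsum, Matrix.conjTranspose_sum, trace_four_sum, Complex.re_sum]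
  refine Finset.sum_congr rfl fun s _ => ?_
  simp only [Matrix.conjTranspose_smul, Matrix.smul_mul, Matrix.mul_smul, Matrix.trace_smul,
    trace_tensor_depolUnit h ρ fun m => (s m).1, smul_eq_mul]
  rw [Finset.prod_comm, Fin.prod_univ_four, ← Complex.re_mul_ofReal, ← Complex.re_mul_ofReal]
  congr 1
  simp only [Complex.star_def, map_mul, Complex.conj_ofReal]
  push_cast
  ring

instance (n : ℕ) : IsProbabilityMeasure (gaussian n) := by
  unfold gaussian; infer_instance

theorem integrable_prod_gaussKernel {n : ℕ} (ρ : ℝ) (s : Fin 4 → Fin n → Fin 2) :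
    Integrable (fun g : Fin n → ℝ => ∏ i, ∏ m, (ρ * g i) ^ (s m i : ℕ)) (gaussian n) := by
  refine Integrable.fintype_prod (f := fun i x => ∏ m, (ρ * x) ^ (s m i : ℕ)) fun i => ?_
  simp only [mul_pow, Finset.prod_mul_distrib, Finset.prod_pow_eq_pow_sum]
  exact (integrable_pow_gaussianReal _).const_mul _

theorem integral_prod_gaussKernel {n : ℕ} (ρ : ℝ) (s : Fin 4 → Fin n → Fin 2) :
    ∫ g : Fin n → ℝ, ∏ i, ∏ m, (ρ * g i) ^ (s m i : ℕ) ∂(gaussian n) =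
      ∏ i, gaussKernel ρ fun m => s m i :=
  integral_fintype_prod_eq_prod fun i x => ∏ m, (ρ * x) ^ (s m i : ℕ)

theorem integrable_trace_smoothed {h n : ℕ} (ρ : ℝ) (M : (Fin n → Fin 2) → Qubits h) :
    Integrable (fun g => ((smoothed ρ M g).conjTranspose * smoothed ρ M g *
      ((smoothed ρ M g).conjTranspose * smoothed ρ M g)).trace.re) (gaussian n) := by
  simp only [trace_smoothed]
  exact integrable_finsetSum _ fun s _ =>
    (integrable_prod_gaussKernel ρ fun m => (s m).2).const_mul _

/-- Hypercontractivity for multilinear polynomials with matrix coefficients: expanding the fourth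
moment in matrix units and monomials gives a quadrilinear form with nonnegative kernel, the tensor
product of contractive kernels. -/
theorem integral_trace_smoothed_le {h n : ℕ} {ρ : ℝ} (h0 : 0 ≤ ρ) (h1 : 3 * ρ ^ 2 ≤ 1)
    (M : (Fin n → Fin 2) → Qubits h) :
    (2 ^ h : ℝ)⁻¹ * ∫ g, ((smoothed ρ M g).conjTranspose * smoothed ρ M g *
      ((smoothed ρ M g).conjTranspose * smoothed ρ M g)).trace.re ∂(gaussian n) ≤
      ((2 ^ h)⁻¹ * ∑ S, ∑ c, ∑ d, ‖M S c d‖ ^ 2) ^ 2 := by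
  have hK := ((isContractive_qubitKernel h0 h1).pi h).prod ((isContractive_gaussKernel h0 h1).pi n)
  let x : (Fin h → Fin 2 × Fin 2) × (Fin n → Fin 2) → ℝ :=
    fun e => ‖M e.2 (fun i => (e.1 i).1) (fun i => (e.1 i).2)‖
  have hx : ∑ e, x e ^ 2 = ∑ S, ∑ c, ∑ d, ‖M S c d‖ ^ 2 := by
    rw [Fintype.sum_prod_type_right]
    refine Finset.sum_congr rfl fun S _ => ?_
    rw [← (Equiv.arrowProdEquivProdArrow (Fin h) (fun _ => Fin 2) (fun _ => Fin 2)).symm.sum_comp,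
      Fintype.sum_prod_type]
    rfl
  have hle := hK.le (fun _ => x) fun _ _ => norm_nonneg _
  have hsq : √(∑ e, x e ^ 2) ^ 4 = (∑ e, x e ^ 2) ^ 2 := by
    rw [show (4 : ℕ) = 2 * 2 from rfl, pow_mul,
      Real.sq_sqrt (Finset.sum_nonneg fun _ _ => sq_nonneg _)]
  rw [Finset.prod_const, Finset.card_fin, hsq, hx] at hle
  simp only [trace_smoothed]
  rw [integral_finsetSum _ fun s _ => (integrable_prod_gaussKernel ρ fun m => (s m).2).const_mul _]
  simp only [integral_const_mul]
  have hterm : ∀ s : Fin 4 → (Fin h → Fin 2 × Fin 2) × (Fin n → Fin 2),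
      ((starRingEnd ℂ (M (s 0).2 (fun i => ((s 0).1 i).1) (fun i => ((s 0).1 i).2)) *
        M (s 1).2 (fun i => ((s 1).1 i).1) (fun i => ((s 1).1 i).2) *
        starRingEnd ℂ (M (s 2).2 (fun i => ((s 2).1 i).1) (fun i => ((s 2).1 i).2)) *
        M (s 3).2 (fun i => ((s 3).1 i).1) (fun i => ((s 3).1 i).2)).re *
        ((2 ^ h)⁻¹ * ∏ i, qubitKernel ρ fun m => (s m).1 i)) *
        ∫ g : Fin n → ℝ, ∏ i, ∏ m, (ρ * g i) ^ ((s m).2 i : ℕ) ∂(gaussian n) ≤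
      (2 ^ h)⁻¹ * (((∏ i, qubitKernel ρ fun m => (s m).1 i) *
        ∏ i, gaussKernel ρ fun m => (s m).2 i) * ∏ m, x (s m)) := fun s => by
    rw [integral_prod_gaussKernel ρ fun m => (s m).2]
    have hk := hK.nonneg s
    have hre := Complex.re_le_norm
      (starRingEnd ℂ (M (s 0).2 (fun i => ((s 0).1 i).1) (fun i => ((s 0).1 i).2)) *
        M (s 1).2 (fun i => ((s 1).1 i).1) (fun i => ((s 1).1 i).2) *
        starRingEnd ℂ (M (s 2).2 (fun i => ((s 2).1 i).1) (fun i => ((s 2).1 i).2)) *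
        M (s 3).2 (fun i => ((s 3).1 i).1) (fun i => ((s 3).1 i).2))
    simp only [norm_mul, Complex.norm_conj] at hre
    rw [Fin.prod_univ_four]
    have := mul_le_mul_of_nonneg_right hre (mul_nonneg (inv_nonneg.2 (pow_nonneg zero_le_two h)) hk)
    simp only [x]
    linarith
  calc _ ≤ (2 ^ h : ℝ)⁻¹ * ∑ s : Fin 4 → (Fin h → Fin 2 × Fin 2) × (Fin n → Fin 2),
        (2 ^ h)⁻¹ * (((∏ i, qubitKernel ρ fun m => (s m).1 i) *
        ∏ i, gaussKernel ρ fun m => (s m).2 i) * ∏ m, x (s m)) := by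
        exact mul_le_mul_of_nonneg_left (Finset.sum_le_sum fun s _ => hterm s) (by positivity)
    _ = (2 ^ h : ℝ)⁻¹ ^ 2 * ∑ s : Fin 4 → (Fin h → Fin 2 × Fin 2) × (Fin n → Fin 2),
        ((∏ i, qubitKernel ρ fun m => (s m).1 i) *
        ∏ i, gaussKernel ρ fun m => (s m).2 i) * ∏ m, x (s m) := by
        rw [← Finset.mul_sum, sq, mul_assoc]
    _ ≤ (2 ^ h : ℝ)⁻¹ ^ 2 * (∑ S, ∑ c, ∑ d, ‖M S c d‖ ^ 2) ^ 2 := by gcongr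
    _ = _ := (mul_pow _ _ _).symm

/-! ### Schatten norms and traces -/

theorem trace_toEuclideanLin {ι : Type*} [Fintype ι] [DecidableEq ι] (A : Matrix ι ι ℂ) :
    LinearMap.trace ℂ _ (Matrix.toEuclideanLin A) = A.trace := by
  rw [Matrix.toEuclideanLin, Matrix.toLpLin_eq_toLin, Matrix.trace_toLin_eq]

theorem toEuclideanLin_mul {ι : Type*} [Fintype ι] [DecidableEq ι] (A B : Matrix ι ι ℂ) :
    Matrix.toEuclideanLin (A * B) = Matrix.toEuclideanLin A ∘ₗ Matrix.toEuclideanLin B := by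
  rw [Matrix.toEuclideanLin, Matrix.toLpLin_eq_toLin, Matrix.toLin_mul _ (PiLp.basisFun 2 ℂ ι)]

theorem adjoint_comp_toEuclideanLin {ι : Type*} [Fintype ι] [DecidableEq ι] (M : Matrix ι ι ℂ) :
    (Matrix.toEuclideanLin M).adjoint ∘ₗ Matrix.toEuclideanLin M =
      Matrix.toEuclideanLin (M.conjTranspose * M) := by
  rw [← Matrix.toEuclideanLin_conjTranspose_eq_adjoint, toEuclideanLin_mul]

theorem sum_singularValues_sq {ι : Type*} [Fintype ι] [DecidableEq ι] (M : Matrix ι ι ℂ) :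
    ∑ i ∈ Finset.range (Fintype.card ι), (Matrix.toEuclideanLin M).singularValues i ^ 2 =
      ∑ i, ∑ j, ‖M i j‖ ^ 2 := by
  have hn : Module.finrank ℂ (EuclideanSpace ℂ ι) = Fintype.card ι := finrank_euclideanSpace
  have h := (Matrix.toEuclideanLin M).isSymmetric_adjoint_comp_self.re_trace_eq_sum_eigenvalues hn
  have ht : LinearMap.trace ℂ _ ((Matrix.toEuclideanLin M).adjoint ∘ₗ Matrix.toEuclideanLin M) =
      (M.conjTranspose * M).trace := by
    rw [adjoint_comp_toEuclideanLin, trace_toEuclideanLin]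
  rw [ht] at h
  rw [← Fin.sum_univ_eq_sum_range fun i => (Matrix.toEuclideanLin M).singularValues i ^ 2]
  simp only [LinearMap.sq_singularValues_fin _ hn]
  rw [← h, Finset.sum_comm]
  simp only [Matrix.trace, Matrix.diag, Matrix.mul_apply, Matrix.conjTranspose_apply, map_sum,
    Complex.star_def, ← Complex.normSq_eq_conj_mul_self, Complex.normSq_eq_norm_sq]
  rfl

theorem sum_singularValues_pow_four {ι : Type*} [Fintype ι] [DecidableEq ι] (M : Matrix ι ι ℂ) :
    ∑ i ∈ Finset.range (Fintype.card ι), (Matrix.toEuclideanLin M).singularValues i ^ 4 =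
      (M.conjTranspose * M * (M.conjTranspose * M)).trace.re := by
  have hn : Module.finrank ℂ (EuclideanSpace ℂ ι) = Fintype.card ι := finrank_euclideanSpace
  have hS := (Matrix.toEuclideanLin M).isSymmetric_adjoint_comp_self
  have ht : LinearMap.trace ℂ _ (((Matrix.toEuclideanLin M).adjoint ∘ₗ Matrix.toEuclideanLin M) ∘ₗ
      ((Matrix.toEuclideanLin M).adjoint ∘ₗ Matrix.toEuclideanLin M)) =
      (M.conjTranspose * M * (M.conjTranspose * M)).trace := by
    rw [adjoint_comp_toEuclideanLin, ← toEuclideanLin_mul, trace_toEuclideanLin]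
  rw [← ht, LinearMap.trace_eq_sum_inner _ (hS.eigenvectorBasis hn),
    ← Fin.sum_univ_eq_sum_range fun i => (Matrix.toEuclideanLin M).singularValues i ^ 4,
    Complex.re_sum]
  refine Finset.sum_congr rfl fun i _ => ?_
  rw [LinearMap.comp_apply (LinearMap.adjoint _ ∘ₗ _), hS.apply_eigenvectorBasis hn, map_smul,
    hS.apply_eigenvectorBasis hn, inner_smul_right, inner_smul_right,
    inner_self_eq_norm_sq_to_K, OrthonormalBasis.norm_eq_one, show 4 = 2 * 2 from rfl, pow_mul,
    LinearMap.sq_singularValues_fin _ hn]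
  simp [sq]

theorem schattenNorm_two_sq {ι : Type*} [Fintype ι] [DecidableEq ι] (M : Matrix ι ι ℂ) :
    schattenNorm 2 M ^ (2 : ℝ) = (Fintype.card ι : ℝ)⁻¹ * ∑ i, ∑ j, ‖M i j‖ ^ 2 := by
  rw [schattenNorm, ← Real.rpow_mul, one_div_mul_cancel two_ne_zero, Real.rpow_one]
  · simp only [Real.rpow_two, sum_singularValues_sq]
  · exact mul_nonneg (by positivity) (Finset.sum_nonneg fun i _ =>
      Real.rpow_nonneg (LinearMap.singularValues_nonneg _ _) _)

theorem schattenNorm_four_pow {ι : Type*} [Fintype ι] [DecidableEq ι] (M : Matrix ι ι ℂ) :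
    schattenNorm 4 M ^ (4 : ℝ) = (Fintype.card ι : ℝ)⁻¹ *
      (M.conjTranspose * M * (M.conjTranspose * M)).trace.re := by
  rw [schattenNorm, ← Real.rpow_mul, one_div_mul_cancel four_ne_zero, Real.rpow_one]
  · rw [← sum_singularValues_pow_four]
    congr 1
    exact Finset.sum_congr rfl fun i _ => Real.rpow_natCast _ 4
  · exact mul_nonneg (by positivity) (Finset.sum_nonneg fun i _ =>
      Real.rpow_nonneg (LinearMap.singularValues_nonneg _ _) _)

/-! ### Completeness of the Hermite polynomials -/

theorem memLp_prod_eval {n : ℕ} (P : Fin n → Polynomial ℝ) :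
    MemLp (fun x : Fin n → ℝ => ∏ i, (P i).eval (x i)) 2 (gaussian n) := by
  have hc : Continuous fun x : Fin n → ℝ => ∏ i, (P i).eval (x i) :=
    continuous_finsetProd _ fun i _ => (P i).continuous.comp (continuous_apply i)
  rw [memLp_two_iff_integrable_sq hc.aestronglyMeasurable]
  simp only [← Finset.prod_pow, ← Polynomial.eval_pow]
  exact Integrable.fintype_prod (f := fun i x => (P i ^ 2).eval x) fun i =>
    integrable_eval_gaussianReal _

theorem hermiteFun_eq {n : ℕ} (τ : Fin n → ℕ) (x : Fin n → ℝ) :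
    hermiteFun τ x = ∏ i, (Polynomial.C (√((τ i).factorial : ℝ))⁻¹ *
      (Polynomial.hermite (τ i)).map (Int.castRingHom ℝ)).eval (x i) := by
  refine Finset.prod_congr rfl fun i _ => ?_
  rw [Polynomial.eval_mul, Polynomial.eval_C, Polynomial.eval_map, Polynomial.aeval_def,
    div_eq_inv_mul]
  rfl

theorem memLp_hermiteFun {n : ℕ} (τ : Fin n → ℕ) : MemLp (hermiteFun τ) 2 (gaussian n) := by
  have := memLp_prod_eval fun i => Polynomial.C (√((τ i).factorial : ℝ))⁻¹ *
      (Polynomial.hermite (τ i)).map (Int.castRingHom ℝ)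
  simpa only [← hermiteFun_eq] using this

theorem exists_finsupp_sum_hermite (P : Polynomial ℝ) :
    ∃ c : ℕ →₀ ℝ, P = c.sum fun k a => a • (Polynomial.hermite k).map (Int.castRingHom ℝ) := by
  let S : Polynomial.Sequence ℝ :=
    ⟨fun k => (Polynomial.hermite k).map (Int.castRingHom ℝ), fun k => by
      rw [(Polynomial.hermite_monic k).degree_map, Polynomial.degree_hermite]⟩
  have h := S.span fun k => by
    have : (S k).leadingCoeff = 1 := (Polynomial.hermite_monic k).map _
    rw [this]
    exact isUnit_one
  have hP : P ∈ Submodule.span ℝ (Set.range S) := h ▸ Submodule.mem_top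
  obtain ⟨c, hc⟩ := Finsupp.mem_span_range_iff_exists_finsupp.1 hP
  exact ⟨c, hc.symm⟩

section Completeness

variable {n : ℕ} {f : (Fin n → ℝ) → ℝ}

/-- Products of one-variable polynomials are linear combinations of Hermite polynomials. -/
theorem integral_prod_eval_mul_eq_zero (hf : MemLp f 2 (gaussian n))
    (h : ∀ τ : Fin n → ℕ, ∫ x, hermiteFun τ x * f x ∂(gaussian n) = 0)
    (P : Fin n → Polynomial ℝ) :
    ∫ x, (∏ i, (P i).eval (x i)) * f x ∂(gaussian n) = 0 := by
  choose c hc using fun i => exists_finsupp_sum_hermite (P i)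
  have e : ∀ x : Fin n → ℝ, (∏ i, (P i).eval (x i)) * f x =
      ∑ τ ∈ Fintype.piFinset fun i => (c i).support,
        (∏ i, c i (τ i) * √((τ i).factorial : ℝ)) * (hermiteFun τ x * f x) := fun x => by
    have e1 : ∀ i, (P i).eval (x i) = ∑ k ∈ (c i).support,
        c i k * ((Polynomial.hermite k).map (Int.castRingHom ℝ)).eval (x i) := fun i => by
      conv_lhs => rw [hc i]
      simp [Finsupp.sum, Polynomial.eval_finsetSum]
    simp only [e1, Finset.prod_univ_sum, Finset.sum_mul]
    refine Finset.sum_congr rfl fun τ _ => ?_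
    rw [← mul_assoc, hermiteFun_eq, ← Finset.prod_mul_distrib]
    congr 1
    refine Finset.prod_congr rfl fun i _ => ?_
    have : √((τ i).factorial : ℝ) ≠ 0 :=
      (Real.sqrt_pos.2 (Nat.cast_pos.2 (Nat.factorial_pos _))).ne'
    rw [Polynomial.eval_mul, Polynomial.eval_C]
    field_simp
  have hint : ∀ τ : Fin n → ℕ, Integrable (fun x => hermiteFun τ x * f x) (gaussian n) := fun τ =>
    (memLp_hermiteFun τ).integrable_mul hf
  simp only [e]
  rw [integral_finsetSum _ fun τ _ => (hint τ).const_mul _]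
  simp only [integral_const_mul, h, mul_zero, Finset.sum_const_zero]

theorem integral_eval_mul_eq_zero (hf : MemLp f 2 (gaussian n))
    (h : ∀ τ : Fin n → ℕ, ∫ x, hermiteFun τ x * f x ∂(gaussian n) = 0)
    (Q : MvPolynomial (Fin n) ℝ) :
    ∫ x, MvPolynomial.eval x Q * f x ∂(gaussian n) = 0 := by
  have key : ∀ d : Fin n →₀ ℕ, Integrable (fun x : Fin n → ℝ => (∏ i, x i ^ d i) * f x)
      (gaussian n) ∧ ∫ x, (∏ i, x i ^ d i) * f x ∂(gaussian n) = 0 := fun d => by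
    have h1 := (memLp_prod_eval fun i => Polynomial.X ^ d i).integrable_mul hf
    have h2 := integral_prod_eval_mul_eq_zero hf h fun i => Polynomial.X ^ d i
    simp only [Polynomial.eval_pow, Polynomial.eval_X] at h1 h2
    exact ⟨h1, h2⟩
  simp only [MvPolynomial.eval_eq', Finset.sum_mul, mul_assoc]
  rw [integral_finsetSum _ fun d _ => (key d).1.const_mul _]
  simp only [integral_const_mul, (key _).2, mul_zero, Finset.sum_const_zero]

theorem dual_apply_eq_sum (L : StrongDual ℝ (Fin n → ℝ)) (x : Fin n → ℝ) :
    L x = ∑ i, L (Pi.single i 1) * x i := by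
  conv_lhs => rw [pi_eq_sum_univ' x]
  simp [mul_comm]

theorem integrable_exp_dual (L : StrongDual ℝ (Fin n → ℝ)) :
    Integrable (fun x => Real.exp (L x)) (gaussian n) := by
  have e : (fun x => Real.exp (L x)) = fun x => ∏ i, Real.exp (L (Pi.single i 1) * x i) := by
    ext x
    rw [dual_apply_eq_sum, Real.exp_sum]
  rw [e]
  exact Integrable.fintype_prod (f := fun i x => Real.exp (L (Pi.single i 1) * x)) fun i =>
    integrable_exp_mul_gaussianReal _

theorem memLp_exp_abs_dual (L : StrongDual ℝ (Fin n → ℝ)) :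
    MemLp (fun x => Real.exp |L x|) 2 (gaussian n) := by
  have hc : Continuous fun x => Real.exp |L x| := by fun_prop
  rw [memLp_two_iff_integrable_sq hc.aestronglyMeasurable]
  refine ((integrable_exp_dual ((2 : ℝ) • L)).add (integrable_exp_dual ((-2 : ℝ) • L))).mono'
    (hc.pow 2).aestronglyMeasurable (Filter.Eventually.of_forall fun x => ?_)
  rw [Real.norm_of_nonneg (by positivity), ← Real.exp_nat_mul]
  simp only [Pi.add_apply, smul_apply, smul_eq_mul]
  rcases abs_cases (L x) with ⟨e, _⟩ | ⟨e, _⟩ <;> rw [e]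
  · exact le_add_of_le_of_nonneg (by norm_num) (Real.exp_pos _).le
  · exact le_add_of_nonneg_of_le (Real.exp_pos _).le (by norm_num)

/-- If all Hermite coefficients vanish, so does the Fourier transform: the exponential series may
be integrated term by term, because `exp |L|` is square integrable. -/
theorem integral_exp_dual_mul_eq_zero (hf : MemLp f 2 (gaussian n))
    (h : ∀ τ : Fin n → ℕ, ∫ x, hermiteFun τ x * f x ∂(gaussian n) = 0)
    (L : StrongDual ℝ (Fin n → ℝ)) :
    ∫ x, Complex.exp (L x * Complex.I) * f x ∂(gaussian n) = 0 := by
  have hs := hasSum_integral_of_dominated_convergence (μ := gaussian n)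
    (F := fun k x => ((L x * Complex.I) ^ k / k.factorial : ℂ) * f x)
    (f := fun x => Complex.exp (L x * Complex.I) * f x)
    (fun k x => |L x| ^ k / k.factorial * |f x|)
    (fun k => by
      have := hf.1
      have hc : Continuous fun x => ((L x * Complex.I) ^ k / k.factorial : ℂ) := by fun_prop
      exact hc.aestronglyMeasurable.mul (Complex.continuous_ofReal.comp_aestronglyMeasurable this))
    (fun k => Filter.Eventually.of_forall fun x => by simp)
    (Filter.Eventually.of_forall fun x => by
      have := (Real.summable_pow_div_factorial |L x|).mul_right |f x|
      exact this)
    (by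
      have : (fun x => ∑' k : ℕ, |L x| ^ k / k.factorial * |f x|) =
          fun x => Real.exp |L x| * |f x| := by
        ext x
        rw [tsum_mul_right, Real.exp_eq_exp_ℝ, NormedSpace.exp_eq_tsum_div]
      rw [this]
      exact (memLp_exp_abs_dual L).integrable_mul hf.abs)
    (Filter.Eventually.of_forall fun x => by
      have := NormedSpace.expSeries_div_hasSum_exp (𝔸 := ℂ) (L x * Complex.I)
      rw [← Complex.exp_eq_exp_ℂ] at this
      exact this.mul_right _)
  have hz : ∀ k : ℕ, ∫ x, ((L x * Complex.I) ^ k / k.factorial : ℂ) * f x ∂(gaussian n) = 0 := by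
    intro k
    have h1 := integral_eval_mul_eq_zero hf h
      ((∑ i, MvPolynomial.C (L (Pi.single i 1)) * MvPolynomial.X i) ^ k)
    simp only [map_pow, map_sum, map_mul, MvPolynomial.eval_C, MvPolynomial.eval_X,
      ← dual_apply_eq_sum] at h1
    have e : ∀ x, ((L x * Complex.I) ^ k / k.factorial : ℂ) * f x =
        (Complex.I ^ k / k.factorial) * ((L x ^ k * f x : ℝ) : ℂ) := fun x => by
      push_cast
      ring
    simp only [e]
    rw [integral_const_mul, integral_complex_ofReal, h1]
    simp
  simp only [hz] at hs
  exact hs.unique hasSum_zero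

/-- Completeness for real functions: the finite measures with densities `f⁺` and `f⁻` have the same
characteristic function, hence agree. -/
theorem ae_eq_zero_of_hermite_real (hf : MemLp f 2 (gaussian n))
    (h : ∀ τ : Fin n → ℕ, ∫ x, hermiteFun τ x * f x ∂(gaussian n) = 0) :
    f =ᵐ[gaussian n] 0 := by
  have hfi : Integrable f (gaussian n) := hf.integrable one_le_two
  have hm := hfi.aemeasurable
  have hm' : AEMeasurable (fun x => -f x) (gaussian n) := hm.neg
  have hfin : ∀ s : ℝ → ℝ, Integrable (fun x => s (f x)) (gaussian n) →
      IsFiniteMeasure ((gaussian n).withDensity fun x => ENNReal.ofReal (s (f x))) := fun s hs =>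
    isFiniteMeasure_withDensity_ofReal hs.2
  have h1 := hfin id hfi
  have h2 := hfin (fun t => -t) hfi.neg
  have hchar : (gaussian n).withDensity (fun x => ENNReal.ofReal (f x)) =
      (gaussian n).withDensity fun x => ENNReal.ofReal (-f x) := by
    change IsFiniteMeasure ((gaussian n).withDensity fun x => ENNReal.ofReal (f x)) at h1
    refine Measure.ext_of_charFunDual ?_
    ext L
    have hb : ∀ g : (Fin n → ℝ) → ℝ, Integrable g (gaussian n) →
        Integrable (fun x => g x • Complex.exp (L x * Complex.I)) (gaussian n) := fun g hg => by
      have hc : Continuous fun x => Complex.exp (L x * Complex.I) := by fun_prop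
      refine hg.mono (hg.1.smul hc.aestronglyMeasurable) (Filter.Eventually.of_forall fun x => ?_)
      rw [norm_smul, Complex.norm_exp_ofReal_mul_I, mul_one]
    rw [charFunDual_apply, charFunDual_apply,
      integral_withDensity_eq_integral_toReal_smul₀ hm.ennreal_ofReal
        (Filter.Eventually.of_forall fun x => ENNReal.ofReal_lt_top),
      integral_withDensity_eq_integral_toReal_smul₀ hm'.ennreal_ofReal
        (Filter.Eventually.of_forall fun x => ENNReal.ofReal_lt_top), ← sub_eq_zero]
    simp only [ENNReal.toReal_ofReal']
    rw [← integral_sub (hb _ hfi.pos_part) (hb _ hfi.neg_part)]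
    rw [← integral_exp_dual_mul_eq_zero hf h L]
    refine integral_congr_ae (Filter.Eventually.of_forall fun x => ?_)
    simp only [Complex.real_smul]
    rw [← sub_mul, ← Complex.ofReal_sub, max_zero_sub_eq_self, mul_comm]
  have hae := (withDensity_eq_iff hm.ennreal_ofReal hm'.ennreal_ofReal
    (by
      have := h1.measure_univ_lt_top
      rw [withDensity_apply _ MeasurableSet.univ, Measure.restrict_univ] at this
      exact this.ne)).1 hchar
  filter_upwards [hae] with x hx
  have hx' := congrArg ENNReal.toReal hx
  simp only [ENNReal.toReal_ofReal'] at hx'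
  rw [← max_zero_sub_max_neg_zero_eq_self (f x), hx', sub_self]
  rfl

/-- The Hermite polynomials are complete in `L²`. -/
theorem ae_eq_zero_of_hermiteCoeff {f : (Fin n → ℝ) → ℂ} (hf : MemLp f 2 (gaussian n))
    (h : ∀ τ, hermiteCoeff f τ = 0) : f =ᵐ[gaussian n] 0 := by
  have hint : ∀ τ : Fin n → ℕ, Integrable (fun x => (hermiteFun τ x : ℂ) * f x) (gaussian n) :=
    fun τ => (memLp_hermiteFun τ).ofReal.integrable_mul hf
  have hre := ae_eq_zero_of_hermite_real hf.re fun τ => by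
    have := integral_re (hint τ)
    rw [show ∫ x, (hermiteFun τ x : ℂ) * f x ∂(gaussian n) = 0 from h τ] at this
    simpa using this
  have him := ae_eq_zero_of_hermite_real hf.im fun τ => by
    have := integral_im (hint τ)
    rw [show ∫ x, (hermiteFun τ x : ℂ) * f x ∂(gaussian n) = 0 from h τ] at this
    simpa using this
  filter_upwards [hre, him] with x h1 h2
  exact Complex.ext h1 h2

end Completeness

/-! ### The Hermite expansion of a multilinear function -/

theorem integral_hermite (k : ℕ) :
    ∫ x, ((Polynomial.hermite k).map (Int.castRingHom ℝ)).eval x ∂(gaussianReal 0 1) =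
      if k = 0 then 1 else 0 := by
  rcases k with _ | k
  · simp
  · have h := integral_eval_mul_id_gaussianReal
      ((Polynomial.hermite k).map (Int.castRingHom ℝ))
    rw [Polynomial.hermite_succ, Polynomial.map_sub, Polynomial.map_mul, Polynomial.map_X,
      ← Polynomial.derivative_map]
    simp only [Polynomial.eval_sub]
    rw [integral_sub (integrable_eval_gaussianReal _) (integrable_eval_gaussianReal _)]
    simp only [Polynomial.eval_mul, Polynomial.eval_X]
    rw [h, sub_self]
    simp

theorem integral_hermite_mul_id (k : ℕ) :
    ∫ x, ((Polynomial.hermite k).map (Int.castRingHom ℝ)).eval x * x ∂(gaussianReal 0 1) =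
      if k = 1 then 1 else 0 := by
  rcases k with _ | k
  · simp [integral_id_gaussianReal]
  · let H := (Polynomial.hermite k).map (Int.castRingHom ℝ)
    have h := integral_eval_mul_id_gaussianReal (Polynomial.X * H)
    have hd : (Polynomial.X * H).derivative = H + Polynomial.X * H.derivative := by
      rw [Polynomial.derivative_mul, Polynomial.derivative_X, one_mul]
    have e : ∀ x, ((Polynomial.hermite (k + 1)).map (Int.castRingHom ℝ)).eval x * x =
        x * (Polynomial.X * H).eval x - (Polynomial.X * H.derivative).eval x := fun x => by
      rw [Polynomial.hermite_succ, Polynomial.map_sub, Polynomial.map_mul, Polynomial.map_X,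
        ← Polynomial.derivative_map]
      simp only [Polynomial.eval_sub, Polynomial.eval_mul, Polynomial.eval_X, H]
      ring
    have hi : Integrable (fun x => x * (Polynomial.X * H).eval x) (gaussianReal 0 1) := by
      have e2 : (fun x => x * (Polynomial.X * H).eval x) =
          fun x => (Polynomial.X * (Polynomial.X * H)).eval x := by
        ext x
        rw [Polynomial.eval_mul (p := Polynomial.X) (q := Polynomial.X * H), Polynomial.eval_X]
      rw [e2]
      exact integrable_eval_gaussianReal _
    simp only [e]
    rw [integral_sub hi (integrable_eval_gaussianReal _), h, hd]
    simp only [Polynomial.eval_add]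
    rw [integral_add (integrable_eval_gaussianReal _) (integrable_eval_gaussianReal _),
      add_sub_cancel_right, integral_hermite]
    simp

theorem integral_hermiteFun_mul_monomial {n : ℕ} (τ : Fin n → ℕ) (S : Fin n → Fin 2) :
    ∫ x, hermiteFun τ x * ∏ i, x i ^ (S i : ℕ) ∂(gaussian n) =
      if τ = fun i => (S i : ℕ) then 1 else 0 := by
  have h1 : ∀ (k : ℕ) (s : Fin 2), ∫ x, (Polynomial.C (√(k.factorial : ℝ))⁻¹ *
      (Polynomial.hermite k).map (Int.castRingHom ℝ)).eval x * x ^ (s : ℕ) ∂(gaussianReal 0 1) =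
      if k = (s : ℕ) then 1 else 0 := fun k s => by
    simp only [Polynomial.eval_mul, Polynomial.eval_C, mul_assoc, integral_const_mul]
    fin_cases s
    · simp only [pow_zero, mul_one, integral_hermite]
      split_ifs with hk <;> simp [hk]
    · simp only [pow_one, integral_hermite_mul_id]
      split_ifs with hk <;> simp [hk]
  simp only [hermiteFun_eq, ← Finset.prod_mul_distrib]
  refine (integral_fintype_prod_eq_prod fun i x => (Polynomial.C (√((τ i).factorial : ℝ))⁻¹ *
      (Polynomial.hermite (τ i)).map (Int.castRingHom ℝ)).eval x * x ^ (S i : ℕ)).trans ?_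
  simp only [h1, funext_iff]
  split_ifs with h
  · exact Finset.prod_eq_one fun i _ => by simp [h i]
  · push Not at h
    obtain ⟨i, hi⟩ := h
    exact Finset.prod_eq_zero (Finset.mem_univ i) (by simp [hi])

theorem memLp_monomial {n : ℕ} (S : Fin n → Fin 2) :
    MemLp (fun x : Fin n → ℝ => ∏ i, x i ^ (S i : ℕ)) 2 (gaussian n) := by
  simpa using memLp_prod_eval fun i => Polynomial.X ^ (S i : ℕ)

/-- A multilinear function is almost everywhere equal to the polynomial given by its Hermite
coefficients, since `H_τ` is the monomial `x^τ` for `τ ∈ {0,1}ⁿ`. -/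
theorem IsMultilinear.ae_eq {n : ℕ} {p : (Fin n → ℝ) → ℂ} (hp : MemLp p 2 (gaussian n))
    (hml : IsMultilinear p) : p =ᵐ[gaussian n] fun x => ∑ S : Fin n → Fin 2,
      hermiteCoeff p (fun i => (S i : ℕ)) * ((∏ i, x i ^ (S i : ℕ) : ℝ) : ℂ) := by
  have hq : MemLp (fun x : Fin n → ℝ => ∑ S : Fin n → Fin 2,
      hermiteCoeff p (fun i => (S i : ℕ)) * ((∏ i, x i ^ (S i : ℕ) : ℝ) : ℂ)) 2 (gaussian n) :=
    memLp_finsetSum _ fun S _ => (memLp_monomial S).ofReal.const_mul _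
  have hint : ∀ (τ : Fin n → ℕ) (S : Fin n → Fin 2), Integrable
      (fun x => (hermiteFun τ x : ℂ) * ((∏ i, x i ^ (S i : ℕ) : ℝ) : ℂ)) (gaussian n) :=
    fun τ S => (memLp_hermiteFun τ).ofReal.integrable_mul (memLp_monomial S).ofReal
  have hcoeff : ∀ τ, hermiteCoeff (fun x : Fin n → ℝ => ∑ S : Fin n → Fin 2,
      hermiteCoeff p (fun i => (S i : ℕ)) * ((∏ i, x i ^ (S i : ℕ) : ℝ) : ℂ)) τ =
      hermiteCoeff p τ := fun τ => by
    have e : hermiteCoeff (fun x : Fin n → ℝ => ∑ S : Fin n → Fin 2,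
        hermiteCoeff p (fun i => (S i : ℕ)) * ((∏ i, x i ^ (S i : ℕ) : ℝ) : ℂ)) τ =
        ∑ S : Fin n → Fin 2, hermiteCoeff p (fun i => (S i : ℕ)) *
          if τ = fun i => (S i : ℕ) then 1 else 0 := by
      rw [hermiteCoeff]
      simp only [Finset.mul_sum, mul_left_comm (hermiteFun τ _ : ℂ)]
      rw [integral_finsetSum _ fun S _ => (hint τ S).const_mul _]
      refine Finset.sum_congr rfl fun S _ => ?_
      rw [integral_const_mul]
      simp only [← Complex.ofReal_mul]
      rw [integral_complex_ofReal, integral_hermiteFun_mul_monomial]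
      split_ifs <;> simp
    rw [e]
    by_cases hτ : hermiteCoeff p τ = 0
    · rw [hτ]
      refine Finset.sum_eq_zero fun S _ => ?_
      split_ifs with h
      · rw [← h, hτ, zero_mul]
      · rw [mul_zero]
    · have h01 := hml τ hτ
      have hlt : ∀ i, τ i < 2 := fun i => by have := h01 i; omega
      rw [Finset.sum_eq_single fun i => ⟨τ i, hlt i⟩]
      · simp
      · intro S _ hS
        rw [if_neg, mul_zero]
        rintro rfl
        exact hS rfl
      · simp
  have h0 := ae_eq_zero_of_hermiteCoeff (hp.sub hq) fun τ => by
    have i1 := (memLp_hermiteFun τ).ofReal (K := ℂ) |>.integrable_mul hp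
    have i2 := (memLp_hermiteFun τ).ofReal (K := ℂ) |>.integrable_mul hq
    have := hcoeff τ
    simp only [hermiteCoeff, Pi.sub_apply, mul_sub] at this ⊢
    exact (integral_sub i1 i2).trans (sub_eq_zero.2 this.symm)
  filter_upwards [h0] with x hx
  exact sub_eq_zero.1 hx

/-! ### The Ornstein–Uhlenbeck operator -/

/-- Rotation invariance of the Gaussian measure in the plane. -/
theorem map_gaussianReal_prod {ρ : ℝ} (h : ρ ^ 2 ≤ 1) :
    ((gaussianReal 0 1).prod (gaussianReal 0 1)).map
      (fun w : ℝ × ℝ => ρ * w.1 + √(1 - ρ ^ 2) * w.2) = gaussianReal 0 1 := by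
  have h1 : ((gaussianReal 0 1).prod (gaussianReal 0 1)).map (fun w : ℝ × ℝ => ρ * w.1) =
      gaussianReal (ρ * 0) (.mk (ρ ^ 2) (sq_nonneg _) * 1) := by
    rw [← gaussianReal_map_const_mul ρ]
    refine (Measure.map_map (g := (ρ * ·)) (by fun_prop) measurable_fst).symm.trans ?_
    simp
  have h2 : ((gaussianReal 0 1).prod (gaussianReal 0 1)).map
      (fun w : ℝ × ℝ => √(1 - ρ ^ 2) * w.2) =
      gaussianReal (√(1 - ρ ^ 2) * 0) (.mk (√(1 - ρ ^ 2) ^ 2) (sq_nonneg _) * 1) := by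
    rw [← gaussianReal_map_const_mul (√(1 - ρ ^ 2))]
    refine (Measure.map_map (g := (√(1 - ρ ^ 2) * ·)) (by fun_prop) measurable_snd).symm.trans ?_
    simp
  refine (gaussianReal_add_gaussianReal_of_indepFun
    (indepFun_prod (X := (ρ * ·)) (Y := (√(1 - ρ ^ 2) * ·)) (by fun_prop) (by fun_prop))
    h1 h2).trans ?_
  congr 1
  · simp
  · ext
    simp [Real.sq_sqrt (sub_nonneg.2 h)]

theorem measurePreserving_ornsteinUhlenbeck (n : ℕ) {ρ : ℝ} (h : ρ ^ 2 ≤ 1) :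
    MeasurePreserving (fun w : (Fin n → ℝ) × (Fin n → ℝ) => ρ • w.1 + √(1 - ρ ^ 2) • w.2)
      ((gaussian n).prod (gaussian n)) (gaussian n) := by
  have h1 := (measurePreserving_arrowProdEquivProdArrow ℝ ℝ (Fin n)
    (fun _ => gaussianReal 0 1) fun _ => gaussianReal 0 1).symm
  have h2 : MeasurePreserving (fun (w : Fin n → ℝ × ℝ) i => ρ * (w i).1 + √(1 - ρ ^ 2) * (w i).2)
      (Measure.pi fun _ => (gaussianReal 0 1).prod (gaussianReal 0 1)) (gaussian n) := by
    refine ⟨by fun_prop, ?_⟩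
    rw [Measure.pi_map_pi (f := fun _ (w : ℝ × ℝ) => ρ * w.1 + √(1 - ρ ^ 2) * w.2)
      (hμ := fun i => by rw [map_gaussianReal_prod h]; infer_instance)
      fun i => by fun_prop]
    simp only [map_gaussianReal_prod h]
    rfl
  exact h2.comp h1

/-- `U_ρ f z` integrates `f` along an affine map depending on `z`; that changing `f` on a null set
only matters for a null set of points `z` follows from `measurePreserving_ornsteinUhlenbeck`. -/
theorem ornsteinUhlenbeck_congr_ae {n : ℕ} {ρ : ℝ} (h : ρ ^ 2 ≤ 1) {p q : (Fin n → ℝ) → ℂ}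
    (hpq : p =ᵐ[gaussian n] q) :
    ornsteinUhlenbeck ρ p =ᵐ[gaussian n] ornsteinUhlenbeck ρ q := by
  have := (measurePreserving_ornsteinUhlenbeck n h).quasiMeasurePreserving.ae hpq
  filter_upwards [Measure.ae_ae_of_ae_prod this] with z hz
  exact integral_congr_ae hz

theorem ornsteinUhlenbeck_monomials {n : ℕ} (ρ : ℝ) (c : (Fin n → Fin 2) → ℂ) (z : Fin n → ℝ) :
    ornsteinUhlenbeck ρ (fun x => ∑ S, c S * ((∏ i, x i ^ (S i : ℕ) : ℝ) : ℂ)) z =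
      ∑ S, c S * ((∏ i, (ρ * z i) ^ (S i : ℕ) : ℝ) : ℂ) := by
  have hi : ∀ (i : Fin n) (s : Fin 2), Integrable
      (fun x : ℝ => (ρ * z i + √(1 - ρ ^ 2) * x) ^ (s : ℕ)) (gaussianReal 0 1) := fun i s => by
    have h2 := integrable_eval_gaussianReal
      ((Polynomial.C (ρ * z i) + Polynomial.C √(1 - ρ ^ 2) * Polynomial.X) ^ (s : ℕ))
    simpa only [Polynomial.eval_pow, Polynomial.eval_add, Polynomial.eval_mul, Polynomial.eval_C,
      Polynomial.eval_X] using h2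
  have hint : ∀ S : Fin n → Fin 2, Integrable (fun x : Fin n → ℝ =>
      ∏ i, (ρ * z i + √(1 - ρ ^ 2) * x i) ^ (S i : ℕ)) (gaussian n) := fun S =>
    Integrable.fintype_prod (f := fun i x => (ρ * z i + √(1 - ρ ^ 2) * x) ^ (S i : ℕ))
      fun i => hi i _
  rw [ornsteinUhlenbeck]
  simp only [Pi.add_apply, Pi.smul_apply, smul_eq_mul]
  rw [integral_finsetSum _ fun S _ => (hint S).ofReal.const_mul _]
  refine Finset.sum_congr rfl fun S _ => ?_
  rw [integral_const_mul, integral_complex_ofReal]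
  congr 2
  refine (integral_fintype_prod_eq_prod fun i x =>
    (ρ * z i + √(1 - ρ ^ 2) * x) ^ (S i : ℕ)).trans (Finset.prod_congr rfl fun i _ => ?_)
  have h2 : S i = 0 ∨ S i = 1 := by omega
  rcases h2 with e | e
  · simp [e]
  · have hx : Integrable (fun x : ℝ => x) (gaussianReal 0 1) := by
      simpa using integrable_pow_gaussianReal 1
    simp only [e, Fin.val_one, pow_one]
    rw [integral_add (integrable_const _) (hx.const_mul _), integral_const_mul (√(1 - ρ ^ 2)),
      integral_id_gaussianReal]
    simp

/-! ### The product basis -/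

section Basis

variable {h n : ℕ} {B : Fin 4 → Qubit}

theorem normInner_tensorBasis (hB : IsStandardOrthonormalBasis B) (σ τ : Fin h → Fin 4) :
    normInner (tensorBasis B σ) (tensorBasis B τ) = if σ = τ then 1 else 0 := by
  have e : normInner (tensorBasis B σ) (tensorBasis B τ) =
      ∏ i, normInner (B (σ i)) (B (τ i)) := by
    simp only [normInner, tensorBasis, tensor_conjTranspose, tensor_mul, trace_tensor,
      Finset.prod_mul_distrib]
    simp
  simp only [e, hB.orthonormal, funext_iff]
  split_ifs with hστ
  · exact Finset.prod_eq_one fun i _ => by simp [hστ i]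
  · push Not at hστ
    obtain ⟨i, hi⟩ := hστ
    exact Finset.prod_eq_zero (Finset.mem_univ i) (by simp [hi])

theorem normInner_sum_right {ι κ : Type*} [Fintype ι] [Fintype κ] (P : Matrix ι ι ℂ)
    (c : κ → ℂ) (Q : κ → Matrix ι ι ℂ) :
    normInner P (∑ k, c k • Q k) = ∑ k, c k * normInner P (Q k) := by
  simp only [normInner, Matrix.trace_sum, Matrix.mul_smul, Matrix.trace_smul,
    smul_eq_mul, Finset.mul_sum, mul_left_comm]

theorem normInner_sum_left {ι κ : Type*} [Fintype ι] [Fintype κ] (P : Matrix ι ι ℂ)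
    (c : κ → ℂ) (Q : κ → Matrix ι ι ℂ) :
    normInner (∑ k, c k • Q k) P = ∑ k, starRingEnd ℂ (c k) * normInner (Q k) P := by
  simp only [normInner, Matrix.conjTranspose_sum, Matrix.conjTranspose_smul, Matrix.sum_mul,
    Matrix.trace_sum, Matrix.smul_mul, Matrix.trace_smul, smul_eq_mul, Finset.mul_sum,
    mul_left_comm, Complex.star_def]

theorem assocFun_randomOperator (hB : IsStandardOrthonormalBasis B)
    (p : (Fin h → Fin 4) → (Fin n → ℝ) → ℂ) (σ : Fin h → Fin 4) :
    assocFun B (randomOperator B p) σ = p σ := by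
  ext g
  simp [assocFun, randomOperator, normInner_sum_right, normInner_tensorBasis hB]

theorem normInner_self {ι : Type*} [Fintype ι] (M : Matrix ι ι ℂ) :
    normInner M M = (((Fintype.card ι : ℝ)⁻¹ * ∑ i, ∑ j, ‖M i j‖ ^ 2 : ℝ) : ℂ) := by
  rw [Finset.sum_comm]
  simp only [normInner, Matrix.trace, Matrix.diag, Matrix.mul_apply, Matrix.conjTranspose_apply,
    Complex.star_def, Complex.conj_mul']
  push_cast
  rfl

/-- Parseval's identity for the product basis. -/
theorem sum_norm_sq_tensorBasis (hB : IsStandardOrthonormalBasis B) (c : (Fin h → Fin 4) → ℂ) :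
    (2 ^ h : ℝ)⁻¹ * ∑ i, ∑ j, ‖(∑ σ, c σ • tensorBasis B σ) i j‖ ^ 2 = ∑ σ, ‖c σ‖ ^ 2 := by
  have e := normInner_self (∑ σ, c σ • tensorBasis B σ)
  rw [normInner_sum_right] at e
  simp only [normInner_sum_left, normInner_tensorBasis hB, mul_ite, mul_one, mul_zero,
    Finset.sum_ite_eq', Finset.mem_univ, if_true, Complex.mul_conj'] at e
  have hc : (Fintype.card (Fin h → Fin 2) : ℝ) = 2 ^ h := by simp
  rw [hc] at e
  exact_mod_cast e.symm

theorem depolarizing_basis (hB : IsStandardOrthonormalBasis B) (ρ : ℝ) (j : Fin 4) :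
    depolarizing ρ (B j) = (if j ≠ 0 then (ρ : ℂ) else 1) • B j := by
  have ht := hB.orthonormal 0 j
  rw [normInner, hB.zero_eq_one, Matrix.conjTranspose_one, one_mul] at ht
  simp only [depolarizing, LinearMap.coe_mk, AddHom.coe_mk, Matrix.mul_smul, mul_one,
    Matrix.trace_smul, smul_eq_mul]
  by_cases hj : j = 0
  · subst hj
    simp only [if_true, Fintype.card_fin] at ht
    rw [hB.zero_eq_one, ← add_smul]
    simp
  · rw [if_neg (Ne.symm hj)] at ht
    have h0 : (B j).trace = 0 := by simpa using ht
    simp [h0, hj]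

theorem depolarizing_eq_sum (ρ : ℝ) (A : Qubit) :
    depolarizing ρ A = ∑ e : Fin 2 × Fin 2,
      A e.1 e.2 • (depolUnit ρ e).map Complex.ofReal := by
  conv_lhs => rw [Matrix.matrix_eq_sum_single A]
  rw [Fintype.sum_prod_type]
  simp only [map_sum]
  refine Finset.sum_congr rfl fun c _ => Finset.sum_congr rfl fun d _ => ?_
  rw [← depolarizing_single, ← map_smul, Matrix.smul_single, smul_eq_mul, mul_one]

theorem depolarizingPow_tensor (ρ : ℝ) (A : Fin h → Qubit) :
    depolarizingPow ρ (tensor A) = tensor fun i => depolarizing ρ (A i) := by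
  rw [depolarizingPow_eq_sum]
  ext a b
  simp only [depolarizing_eq_sum, tensor, Matrix.sum_apply, Matrix.smul_apply, Matrix.of_apply,
    smul_eq_mul, ← Finset.prod_mul_distrib]
  exact (Fintype.prod_sum fun i (e : Fin 2 × Fin 2) =>
    A i e.1 e.2 * (depolUnit ρ e).map Complex.ofReal (a i) (b i)).symm

theorem depolarizingPow_tensorBasis (hB : IsStandardOrthonormalBasis B) (ρ : ℝ)
    (σ : Fin h → Fin 4) :
    depolarizingPow ρ (tensorBasis B σ) = (ρ : ℂ) ^ weight σ • tensorBasis B σ := by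
  have hw : ∏ i, (if σ i ≠ 0 then (ρ : ℂ) else 1) = (ρ : ℂ) ^ weight σ := by
    rw [Finset.prod_ite, Finset.prod_const, Finset.prod_const_one, mul_one, weight]
  rw [tensorBasis, depolarizingPow_tensor, ← hw]
  ext a b
  simp only [depolarizing_basis hB, tensor, Matrix.of_apply, Matrix.smul_apply, smul_eq_mul,
    Finset.prod_mul_distrib]

theorem depolarizingPow_sum (ρ : ℝ) {κ : Type*} [Fintype κ] (c : κ → ℂ) (Q : κ → Qubits h) :
    depolarizingPow ρ (∑ k, c k • Q k) = ∑ k, c k • depolarizingPow ρ (Q k) := by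
  simp only [depolarizingPow_eq_sum, Matrix.sum_apply, Matrix.smul_apply, Finset.sum_smul,
    Finset.smul_sum, smul_smul, smul_eq_mul]
  exact Finset.sum_comm

theorem smoothed_basis (hB : IsStandardOrthonormalBasis B) (ρ : ℝ)
    (c : (Fin h → Fin 4) → (Fin n → Fin 2) → ℂ) (g : Fin n → ℝ) :
    smoothed ρ (fun S => ∑ σ, c σ S • tensorBasis B σ) g =
      ∑ σ, ((∑ S, c σ S * ((∏ i, (ρ * g i) ^ (S i : ℕ) : ℝ) : ℂ)) * (ρ : ℂ) ^ weight σ) •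
        tensorBasis B σ := by
  simp only [smoothed, depolarizingPow_sum, depolarizingPow_tensorBasis hB, Finset.smul_sum,
    smul_smul, Finset.sum_mul, Finset.sum_smul]
  rw [Finset.sum_comm]
  refine Finset.sum_congr rfl fun σ _ => Finset.sum_congr rfl fun S _ => ?_
  congr 1
  ring

end Basis

/-! ### Norms of random operators -/

theorem normN_congr_ae {h n : ℕ} (q : ℝ) {P Q : (Fin n → ℝ) → Qubits h}
    (hPQ : P =ᵐ[gaussian n] Q) : normN q P = normN q Q := by
  have h : ∫⁻ g, ENNReal.ofReal (schattenNorm q (P g) ^ q) ∂(gaussian n) =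
      ∫⁻ g, ENNReal.ofReal (schattenNorm q (Q g) ^ q) ∂(gaussian n) :=
    lintegral_congr_ae (hPQ.fun_comp fun M => ENNReal.ofReal (schattenNorm q M ^ q))
  simp only [normN, h]

theorem hermiteFun_eq_monomial {n : ℕ} (S : Fin n → Fin 2) (x : Fin n → ℝ) :
    hermiteFun (fun i => (S i : ℕ)) x = ∏ i, x i ^ (S i : ℕ) := by
  refine Finset.prod_congr rfl fun i _ => ?_
  have h2 : S i = 0 ∨ S i = 1 := by omega
  rcases h2 with e | e <;> simp [e]

/-- Parseval's identity for multilinear polynomials in Gaussian variables. -/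
theorem integral_norm_sq_monomials {n : ℕ} (c : (Fin n → Fin 2) → ℂ) :
    Integrable (fun x : Fin n → ℝ => ‖∑ S, c S * ((∏ i, x i ^ (S i : ℕ) : ℝ) : ℂ)‖ ^ 2)
      (gaussian n) ∧
    ∫ x, ‖∑ S, c S * ((∏ i, x i ^ (S i : ℕ) : ℝ) : ℂ)‖ ^ 2 ∂(gaussian n) = ∑ S, ‖c S‖ ^ 2 := by
  have hint : ∀ S T : Fin n → Fin 2, Integrable (fun x : Fin n → ℝ =>
      (∏ i, x i ^ (S i : ℕ)) * ∏ i, x i ^ (T i : ℕ)) (gaussian n) := fun S T =>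
    (memLp_monomial S).integrable_mul (memLp_monomial T)
  have e : ∀ x : Fin n → ℝ, ‖∑ S, c S * ((∏ i, x i ^ (S i : ℕ) : ℝ) : ℂ)‖ ^ 2 =
      ∑ S, ∑ T, (c S * starRingEnd ℂ (c T)).re *
        ((∏ i, x i ^ (S i : ℕ)) * ∏ i, x i ^ (T i : ℕ)) := fun x => by
    have : ((‖∑ S, c S * ((∏ i, x i ^ (S i : ℕ) : ℝ) : ℂ)‖ ^ 2 : ℝ) : ℂ) =
        ∑ S, ∑ T, (c S * starRingEnd ℂ (c T)) *
          (((∏ i, x i ^ (S i : ℕ)) * ∏ i, x i ^ (T i : ℕ) : ℝ) : ℂ) := by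
      rw [Complex.ofReal_pow, ← Complex.mul_conj', map_sum, Finset.sum_mul_sum]
      refine Finset.sum_congr rfl fun S _ => Finset.sum_congr rfl fun T _ => ?_
      rw [map_mul, Complex.conj_ofReal, Complex.ofReal_mul]
      ring
    have h2 := congrArg Complex.re this
    rw [Complex.ofReal_re] at h2
    simpa only [Complex.re_sum, Complex.re_mul_ofReal] using h2
  simp only [e]
  refine ⟨integrable_finsetSum _ fun S _ => integrable_finsetSum _ fun T _ =>
    (hint S T).const_mul _, ?_⟩
  rw [integral_finsetSum _ fun S _ => integrable_finsetSum _ fun T _ => (hint S T).const_mul _]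
  refine Finset.sum_congr rfl fun S _ => ?_
  rw [integral_finsetSum _ fun T _ => (hint S T).const_mul _]
  simp only [integral_const_mul, ← hermiteFun_eq_monomial S, integral_hermiteFun_mul_monomial]
  rw [Finset.sum_eq_single S]
  · rw [if_pos rfl, mul_one, Complex.mul_conj', ← Complex.ofReal_pow, Complex.ofReal_re]
  · intro T _ hT
    rw [if_neg, mul_zero]
    intro hST
    exact hT (funext fun i => Fin.ext (congrFun hST i).symm)
  · simp

theorem normN_two_monomials {h n : ℕ} {B : Fin 4 → Qubit} (hB : IsStandardOrthonormalBasis B)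
    (c : (Fin h → Fin 4) → (Fin n → Fin 2) → ℂ) :
    normN 2 (randomOperator B fun σ (x : Fin n → ℝ) =>
      ∑ S, c σ S * ((∏ i, x i ^ (S i : ℕ) : ℝ) : ℂ)) =
      ENNReal.ofReal (∑ σ, ∑ S, ‖c σ S‖ ^ 2) ^ (1 / 2 : ℝ) := by
  rw [normN]
  congr 1
  have hc : (Fintype.card (Fin h → Fin 2) : ℝ) = 2 ^ h := by simp
  simp only [schattenNorm_two_sq, hc, randomOperator, sum_norm_sq_tensorBasis hB]
  rw [← ofReal_integral_eq_lintegral_ofReal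
    (integrable_finsetSum _ fun σ _ => (integral_norm_sq_monomials (c σ)).1)
    (Filter.Eventually.of_forall fun x => Finset.sum_nonneg fun σ _ => by positivity),
    integral_finsetSum _ fun σ _ => (integral_norm_sq_monomials (c σ)).1]
  simp only [(integral_norm_sq_monomials _).2]

/-- The hypercontractive inequality in terms of the coefficients. -/
theorem normN_four_smoothed_le {h n : ℕ} {B : Fin 4 → Qubit} (hB : IsStandardOrthonormalBasis B)
    {ρ : ℝ} (h0 : 0 ≤ ρ) (h1 : 3 * ρ ^ 2 ≤ 1) (c : (Fin h → Fin 4) → (Fin n → Fin 2) → ℂ) :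
    normN 4 (smoothed ρ fun S => ∑ σ, c σ S • tensorBasis B σ) ≤
      ENNReal.ofReal (∑ σ, ∑ S, ‖c σ S‖ ^ 2) ^ (1 / 2 : ℝ) := by
  have hc : (Fintype.card (Fin h → Fin 2) : ℝ) = 2 ^ h := by simp
  have hle := integral_trace_smoothed_le h0 h1 fun S => ∑ σ, c σ S • tensorBasis B σ
  rw [Finset.mul_sum] at hle
  simp only [sum_norm_sq_tensorBasis hB] at hle
  rw [Finset.sum_comm, ← integral_const_mul] at hle
  have hnn : ∀ M : Qubits h, 0 ≤ (2 ^ h : ℝ)⁻¹ *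
      (M.conjTranspose * M * (M.conjTranspose * M)).trace.re := fun M => by
    rw [← hc, ← schattenNorm_four_pow]
    refine Real.rpow_nonneg (Real.rpow_nonneg (mul_nonneg (by positivity) ?_) _) _
    exact Finset.sum_nonneg fun i _ => Real.rpow_nonneg (LinearMap.singularValues_nonneg _ _) _
  rw [normN]
  simp only [schattenNorm_four_pow, hc]
  rw [← ofReal_integral_eq_lintegral_ofReal ((integrable_trace_smoothed ρ _).const_mul _)
    (Filter.Eventually.of_forall fun g => hnn _)]
  calc _ ≤ ENNReal.ofReal ((∑ σ, ∑ S, ‖c σ S‖ ^ 2) ^ 2) ^ (1 / 4 : ℝ) := by gcongr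
    _ = _ := by
      rw [ENNReal.ofReal_pow (Finset.sum_nonneg fun σ _ => by positivity), ← ENNReal.rpow_natCast,
        ← ENNReal.rpow_mul]
      norm_num

theorem weight_add_sum_le {h n d : ℕ} {p : (Fin h → Fin 4) → (Fin n → ℝ) → ℂ}
    (hd : totalDegree p ≤ ((d : ℕ∞) : WithBot ℕ∞)) {σ : Fin h → Fin 4} {τ : Fin n → ℕ}
    (hτ : hermiteCoeff (p σ) τ ≠ 0) : (∑ i, τ i) + weight σ ≤ d := by
  have h1 : (((∑ i, τ i : ℕ) : ℕ∞) : WithBot ℕ∞) ≤ hermiteDegree (p σ) :=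
    le_iSup₂_of_le (f := fun (τ : Fin n → ℕ) (_ : hermiteCoeff (p σ) τ ≠ 0) =>
      (((∑ i, τ i : ℕ) : ℕ∞) : WithBot ℕ∞)) τ hτ le_rfl
  have h2 : hermiteDegree (p σ) + ((weight σ : ℕ∞) : WithBot ℕ∞) ≤ totalDegree p :=
    le_iSup (fun σ => hermiteDegree (p σ) + ((weight σ : ℕ∞) : WithBot ℕ∞)) σ
  have h3 := ((add_le_add_left h1 _).trans h2).trans hd
  exact_mod_cast h3

end RandomOp

end

open RandomOp in
theorem mainTheorem4 (h n : ℕ) (B : Fin 4 → RandomOp.Qubit)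
    (hB : RandomOp.IsStandardOrthonormalBasis B)
    (p : (Fin h → Fin 4) → (Fin n → ℝ) → ℂ)
    (hp : ∀ σ, MemLp (p σ) 2 (RandomOp.gaussian n))
    (hml : ∀ σ, RandomOp.IsMultilinear (p σ)) :
    (∀ ρ : ℝ, 0 ≤ ρ → ρ ≤ 1 / √3 →
      RandomOp.normN 4 (RandomOp.noise B ρ (RandomOp.randomOperator B p)) ≤
        RandomOp.normN 2 (RandomOp.randomOperator B p)) ∧
    (∀ d : ℕ, RandomOp.totalDegree p ≤ ((d : ℕ∞) : WithBot ℕ∞) →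
      RandomOp.normN 4 (RandomOp.randomOperator B p) ≤
        (3 : ℝ≥0∞) ^ ((d : ℝ) / 2) * RandomOp.normN 2 (RandomOp.randomOperator B p)) := by
  let c : (Fin h → Fin 4) → (Fin n → Fin 2) → ℂ :=
    fun σ S => hermiteCoeff (p σ) fun i => (S i : ℕ)
  have hpq : ∀ σ, p σ =ᵐ[gaussian n]
      fun x => ∑ S, c σ S * ((∏ i, x i ^ (S i : ℕ) : ℝ) : ℂ) := fun σ => (hml σ).ae_eq (hp σ)
  have hP : randomOperator B p =ᵐ[gaussian n] randomOperator B fun σ (x : Fin n → ℝ) =>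
      ∑ S, c σ S * ((∏ i, x i ^ (S i : ℕ) : ℝ) : ℂ) := by
    filter_upwards [ae_all_iff.2 hpq] with g hg
    simp only [randomOperator, hg]
  have hN2 := (normN_congr_ae 2 hP).trans (normN_two_monomials hB c)
  have h3 : (√3 : ℝ) ^ 2 = 3 := Real.sq_sqrt (by norm_num)
  have h3pos : (0 : ℝ) < √3 := by positivity
  refine ⟨fun ρ h0 h1 => ?_, fun d hd => ?_⟩
  · have hρ : 3 * ρ ^ 2 ≤ 1 := by
      have : ρ * √3 ≤ 1 := (le_div_iff₀ h3pos).1 h1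
      have : (ρ * √3) ^ 2 ≤ 1 := pow_le_one₀ (by positivity) this
      rw [mul_pow, h3] at this
      linarith
    have hnoise : noise B ρ (randomOperator B p) =ᵐ[gaussian n]
        smoothed ρ fun S => ∑ σ, c σ S • tensorBasis B σ := by
      have hU := fun σ => ornsteinUhlenbeck_congr_ae (ρ := ρ) (by nlinarith) (hpq σ)
      filter_upwards [ae_all_iff.2 hU] with g hg
      simp only [noise, assocFun_randomOperator hB, hg, ornsteinUhlenbeck_monomials,
        smoothed_basis hB, depolarizingPow_tensorBasis hB, smul_smul]
    rw [normN_congr_ae 4 hnoise, hN2]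
    exact normN_four_smoothed_le hB h0 hρ c
  · -- `P` is the image under the noise with `ρ = 1 / √3` of the operator whose coefficients are
    -- multiplied by `√3 ^ (|S| + |σ|)`.
    let c' : (Fin h → Fin 4) → (Fin n → Fin 2) → ℂ :=
      fun σ S => ((√3 ^ ((∑ i, (S i : ℕ)) + weight σ) : ℝ) : ℂ) * c σ S
    have hsm : randomOperator B (fun σ (x : Fin n → ℝ) =>
        ∑ S, c σ S * ((∏ i, x i ^ (S i : ℕ) : ℝ) : ℂ)) =
        smoothed (√3)⁻¹ fun S => ∑ σ, c' σ S • tensorBasis B σ := by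
      ext1 g
      rw [smoothed_basis hB, randomOperator]
      refine Finset.sum_congr rfl fun σ _ => ?_
      rw [Finset.sum_mul]
      congr 1
      refine Finset.sum_congr rfl fun S _ => ?_
      have e : √3 ^ ((∑ i, (S i : ℕ)) + weight σ) * (√3)⁻¹ ^ (∑ i, (S i : ℕ)) *
          (√3)⁻¹ ^ weight σ = 1 := by
        rw [mul_assoc, ← pow_add, ← mul_pow, mul_inv_cancel₀ h3pos.ne', one_pow]
      have e' := congrArg Complex.ofReal e
      simp only [c', mul_pow, Finset.prod_mul_distrib, Finset.prod_pow_eq_pow_sum]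
      push_cast at e' ⊢
      linear_combination (-(c σ S * ∏ i, (g i : ℂ) ^ (S i : ℕ))) * e'
    have hsum : ∑ σ, ∑ S, ‖c' σ S‖ ^ 2 ≤ 3 ^ d * ∑ σ, ∑ S, ‖c σ S‖ ^ 2 := by
      simp only [Finset.mul_sum]
      refine Finset.sum_le_sum fun σ _ => Finset.sum_le_sum fun S _ => ?_
      by_cases hcS : c σ S = 0
      · simp [c', hcS]
      · have hdeg := weight_add_sum_le hd hcS
        simp only [c']
        rw [norm_mul, mul_pow, Complex.norm_of_nonneg (by positivity), pow_right_comm, h3]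
        gcongr
        norm_num
    have h4 := normN_four_smoothed_le (h := h) (n := n) hB (ρ := (√3)⁻¹) (by positivity)
      (by rw [inv_pow, h3]; norm_num) c'
    rw [normN_congr_ae 4 hP, hN2, hsm]
    refine h4.trans ?_
    calc _ ≤ ENNReal.ofReal (3 ^ d * ∑ σ, ∑ S, ‖c σ S‖ ^ 2) ^ (1 / 2 : ℝ) := by gcongr
      _ = _ := by
        rw [ENNReal.ofReal_mul (by positivity), ENNReal.mul_rpow_of_nonneg _ _ (by norm_num),
          ENNReal.ofReal_pow (by norm_num), ← ENNReal.rpow_natCast, ← ENNReal.rpow_mul,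
          ENNReal.ofReal_ofNat, mul_one_div]
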